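/- For $n\ge 2$ let $(Q_1,\dots,Q_n)$ be a uniformly distributed random permutation of $\{1,\dots,n\}$ and $Z_i=\sqrt{\tfrac{12}{n^2-1}}\,\bigl(Q_i-\tfrac{n+1}{2}\bigr)$. For random variables $\xi_1,\dots,\xi_N$ let $$\mathbf C(\xi_1,\dots,\xi_N)=\mathrm i^{-N}\,\frac{\partial^N}{\partial x_1\cdots\partial x_N}\log\mathbb E\exp\Bigl(\sum_{j=1}^N\mathrm i x_j\xi_j\Bigr)\Big|_{x=0}$$ be their joint cumulant. Fix nonnegative integers $k_1,\dots,k_r$, put $k=\sum_i k_i$, $\mathbf k_0=0$ and $\mathbf k_i=2\sum_{j\le i}k_j$, and let $\pi_1$ be the perfect matching of $[2k]=\{1,\dots,2k\}$ whose blocks are, for each $i$ with $k_i\geq 1$, $\{\mathbf k_{i-1}+2,\mathbf k_{i-1}+3\},\{\mathbf k_{i-1}+4,\mathbf k_{i-1}+5\},\dots,\{\mathbf k_i,\mathbf k_{i-1}+1\}$. Let $\pi$ be a partition of $[2k]$ all of whose blocks have even cardinality, and let $\pi\vee\pi_1$ be the least upper bound of $\pi$ and $\pi_1$ in the refinement order.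 For a partition $\sigma$ write $\#\sigma$ for its number of blocks and $\sigma|_B=\{E\in\sigma:E\subset B\}$; a word with entries in $[n]$ is called $\sigma$-measurable if it is constant on each block of $\sigma$. 1. Let $B$ be a block of $\pi\vee\pi_1$, let $A^{(1)},\dots,A^{(m)}$ be the blocks of $\pi$ contained in $B$, and let $\mathfrak a(\beta)=\#A^{(\beta)}/2$. If exactly one $\beta$ has $\mathfrak a(\beta)\ge 3$ and no $\beta$ has $\mathfrak a(\beta)=2$, then $$\sum_{\mathbf j|_B}\ \prod_{\beta=1}^m\bigl|\mathbf C\{Z_{j_\alpha}\}_{\alpha\in A^{(\beta)}}\bigr|=O\Bigl(n^{\sum_{\beta=1}^m(\mathfrak a(\beta)-2)\mathbf 1_{\{\mathfrak a(\beta)\ge2\}}}\Bigr),$$ where the sum runs over all $\pi_1|_B$-measurable words $\mathbf j|_B=(j_\alpha)_{\alpha\in B}\in[n]^B$. 2. Let $\mathfrak n_\gamma(\pi)$ be the number of blocks of $\pi$ of cardinality $2\gamma$, and $\mathbf C_\pi(\mathbf j)=\prod_{A\in\pi}\mathbf C\{Z_{j_\alpha}\}_{\alpha\in A}$. If $\mathfrak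 n_2(\pi)=0$ and $\sum_{\gamma\ge3}\mathfrak n_\gamma(\pi)=1$, then $$\sum_{\mathbf j}\bigl|\mathbf C_\pi(\mathbf j)\bigr|=O\Bigl(n^{\#(\pi_1\vee\pi)-1+\sum_{\gamma\ge2}(\gamma-2)\mathfrak n_\gamma(\pi)}\Bigr),$$ where the sum runs over all $\pi_1$-measurable words $\mathbf j\in[n]^{2k}$. In both parts the implied constant does not depend on $n\ge2$ (it may depend on $k_1,\dots,k_r$, $\pi$ and $B$). -/

import Mathlib

open Finset MeasureTheory ProbabilityTheory
open scoped BigOperators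

noncomputable section

namespace SpearmanCumulant

/-! ### Joint cumulants -/

/-- The joint cumulant `C(ξ₁, …, ξ_N) = i^{-N} ∂^N/∂x₁⋯∂x_N log E exp(i ∑ x_j ξ_j)` at `x = 0`. -/
def jointCumulant {Ω : Type*} [MeasurableSpace Ω] (μ : Measure Ω) {N : ℕ}
    (ξ : Fin N → Ω → ℝ) : ℂ :=
  (Complex.I ^ N)⁻¹ *
    iteratedFDeriv ℝ N
      (fun x : Fin N → ℝ =>
        Complex.log (∫ ω, Complex.exp (∑ j, Complex.I * (x j : ℂ) * (ξ j ω : ℂ)) ∂μ))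
      0 (fun j => Pi.single j 1)

/-! ### The normalized uniform random permutation -/

instance permMeasurableSpace (n : ℕ) : MeasurableSpace (Equiv.Perm (Fin n)) := ⊤

instance permDiscrete (n : ℕ) : DiscreteMeasurableSpace (Equiv.Perm (Fin n)) := ⟨fun _ => trivial⟩

/-- The uniform distribution on the permutations of an `n`-element set. -/
def permMeasure (n : ℕ) : Measure (Equiv.Perm (Fin n)) := uniformOn Set.univ

/-- `Z_i = √(12 / (n² - 1)) (Q_i - (n + 1) / 2)`, where `Q_i = q i + 1 ∈ {1, …, n}`. -/
def Z (n : ℕ) (i : Fin n) (q : Equiv.Perm (Fin n)) : ℝ :=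
  Real.sqrt (12 / ((n : ℝ) ^ 2 - 1)) * ((((q i : ℕ) : ℝ) + 1) - ((n : ℝ) + 1) / 2)

/-- The cumulant `C{Z_{j_α}}_{α ∈ A}` for a finite set `A` of positions and a word `j` on `A`
(the positions are listed in increasing order). -/
def blockCumulant {M : ℕ} (n : ℕ) (A : Finset (Fin M)) (j : A → Fin n) : ℂ :=
  jointCumulant (permMeasure n) (fun i : Fin A.card => Z n (j (A.orderIsoOfFin rfl i)))

/-! ### Set partitions -/

/-- The partitions of the set of the `M` positions (numbered from `0`). -/
abbrev Part (M : ℕ) : Type := Finpartition (univ : Finset (Fin M))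

open scoped Classical in
/-- The join `π ∨ ρ` of two partitions: its blocks are the classes of the equivalence relation
generated by "same block of `π`" and "same block of `ρ`". -/
def join {M : ℕ} (π ρ : Part M) : Part M :=
  Finpartition.ofSetoid (Setoid.ker π.part ⊔ Setoid.ker ρ.part)

/-- `join π ρ` is the least upper bound of `π` and `ρ` in the refinement order. -/
theorem join_isLUB {M : ℕ} (π ρ : Part M) : IsLUB {π, ρ} (join π ρ) := by
  have key : ∀ σ τ : Part M, σ ≤ τ ↔ ∀ a b, σ.part a = σ.part b → τ.part a = τ.part b := by
    intro σ τ
    constructor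
    · intro h a b hab
      obtain ⟨C, hC, hsub⟩ := h (σ.part_mem.2 (mem_univ a))
      have ha := hsub (σ.mem_part (mem_univ a))
      have hb := hsub (hab ▸ σ.mem_part (mem_univ b))
      rw [τ.part_eq_of_mem hC ha, τ.part_eq_of_mem hC hb]
    · intro h A hA
      obtain ⟨a, ha⟩ := σ.nonempty_of_mem_parts hA
      refine ⟨τ.part a, τ.part_mem.2 (mem_univ a), fun b hb => ?_⟩
      have := h a b (by rw [σ.part_eq_of_mem hA ha, σ.part_eq_of_mem hA hb])
      rw [this]
      exact τ.mem_part (mem_univ b)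
  have hj : ∀ a b, (join π ρ).part a = (join π ρ).part b ↔
      (Setoid.ker π.part ⊔ Setoid.ker ρ.part) a b := by
    intro a b
    classical
    rw [← Finpartition.mem_part_ofSetoid_iff_rel]
    constructor
    · intro h
      have := (join π ρ).mem_part (mem_univ b)
      rw [← h] at this
      convert this using 2
      unfold join
      congr!
    · intro h
      have h' : b ∈ (join π ρ).part a := by
        convert h using 2
        unfold join
        congr!
      exact ((join π ρ).part_eq_of_mem ((join π ρ).part_mem.2 (mem_univ a)) h').symm
  constructor
  · rintro σ (rfl | rfl)
    · exact (key _ _).2 fun a b hab => (hj a b).2 ((le_sup_left : _ ≤ _ ⊔ Setoid.ker ρ.part) hab)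
    · exact (key _ _).2 fun a b hab => (hj a b).2 ((le_sup_right : _ ≤ Setoid.ker π.part ⊔ _) hab)
  · intro τ hτ
    refine (key _ _).2 fun a b hab => ?_
    have hle : Setoid.ker π.part ⊔ Setoid.ker ρ.part ≤ Setoid.ker τ.part :=
      sup_le (fun {x y} h => (key _ _).1 (hτ (Or.inl rfl)) x y h)
        (fun {x y} h => (key _ _).1 (hτ (Or.inr rfl)) x y h)
    exact hle ((hj a b).1 hab)

/-- The `t`-th block of the `i`-th cycle of `π₁`: on the `2 k_i` positions of the `i`-th group,
numbered locally from `0`, it is `{2t + 1, 2t + 2}`, with `2 k_i` read as `0`. -/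
def pi1Block {r : ℕ} (k : Fin r → ℕ) (i : Fin r) (t : Fin (k i)) :
    Finset (Fin (∑ i, 2 * k i)) :=
  {finSigmaFinEquiv (n := fun i => 2 * k i) ⟨i, ⟨2 * t + 1, by have := t.2; omega⟩⟩,
   finSigmaFinEquiv (n := fun i => 2 * k i)
    ⟨i, ⟨(2 * t + 2) % (2 * k i), Nat.mod_lt _ (by have := t.2; omega)⟩⟩}

/-- The blocks of `π₁`. -/
def pi1Blocks {r : ℕ} (k : Fin r → ℕ) : Finset (Finset (Fin (∑ i, 2 * k i))) :=
  (univ : Finset ((i : Fin r) × Fin (k i))).image (fun p => pi1Block k p.1 p.2)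

theorem mem_pi1Block {r : ℕ} (k : Fin r → ℕ) (i i' : Fin r) (s : Fin (2 * k i))
    (t : Fin (k i')) :
    finSigmaFinEquiv (n := fun i => 2 * k i) ⟨i, s⟩ ∈ pi1Block k i' t ↔
      i = i' ∧ ((s : ℕ) = 2 * t + 1 ∨ (s : ℕ) = (2 * t + 2) % (2 * k i')) := by
  rw [pi1Block, mem_insert, mem_singleton, finSigmaFinEquiv.apply_eq_iff_eq,
    finSigmaFinEquiv.apply_eq_iff_eq]
  constructor
  · rintro (h | h) <;> cases h <;> simp
  · rintro ⟨rfl, h | h⟩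
    · left; congr 1; exact Fin.ext h
    · right; congr 1; exact Fin.ext h

theorem pi1_existsUnique {r : ℕ} (k : Fin r → ℕ) (a : Fin (∑ i, 2 * k i)) :
    ∃! E, E ∈ pi1Blocks k ∧
      a ∈ E := by
  obtain ⟨⟨i, s⟩, rfl⟩ := (finSigmaFinEquiv (n := fun i => 2 * k i)).surjective a
  have hs : (s : ℕ) < 2 * k i := s.2
  have hmod : ∀ t : ℕ, t < k i →
      (2 * t + 2) % (2 * k i) = if t + 1 = k i then 0 else 2 * t + 2 := by
    intro t ht
    split_ifs with h
    · rw [← h, show 2 * t + 2 = 2 * (t + 1) by ring, Nat.mod_self]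
    · exact Nat.mod_eq_of_lt (by omega)
  have hex : ∃ t : Fin (k i), (s : ℕ) = 2 * t + 1 ∨ (s : ℕ) = (2 * t + 2) % (2 * k i) := by
    by_cases h0 : (s : ℕ) = 0
    · refine ⟨⟨k i - 1, by omega⟩, Or.inr ?_⟩
      rw [hmod _ (by simp; omega)]
      simp only [h0]
      rw [if_pos (by omega)]
    · refine ⟨⟨(s - 1) / 2, by omega⟩, ?_⟩
      rw [hmod _ (by simp; omega)]
      simp only
      split_ifs <;> omega
  obtain ⟨t, ht⟩ := hex
  refine ⟨pi1Block k i t, ⟨mem_image.2 ⟨⟨i, t⟩, mem_univ _, rfl⟩,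
    (mem_pi1Block k i i s t).2 ⟨rfl, ht⟩⟩, ?_⟩
  rintro E ⟨hE, hmem⟩
  obtain ⟨⟨i', t'⟩, -, rfl⟩ := mem_image.1 hE
  obtain ⟨rfl, ht'⟩ := (mem_pi1Block k i i' s t').1 hmem
  have : t' = t := by
    have h1 := t.2
    have h2 := t'.2
    rw [hmod _ h1] at ht
    rw [hmod _ h2] at ht'
    apply Fin.ext
    split_ifs at ht ht' <;> omega
  rw [this]

theorem empty_notMem_pi1Blocks {r : ℕ} (k : Fin r → ℕ) : ∅ ∉ pi1Blocks k := by
  intro h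
  obtain ⟨p, -, hp⟩ := mem_image.1 h
  exact insert_ne_empty _ _ hp

/-- The perfect matching `π₁` of the `2k = ∑ 2 k_i` positions. -/
def pi1 {r : ℕ} (k : Fin r → ℕ) : Part (∑ i, 2 * k i) :=
  Finpartition.ofExistsUnique (pi1Blocks k) (fun _ _ => subset_univ _)
    (fun a _ => pi1_existsUnique k a) (empty_notMem_pi1Blocks k)

/-- `σ|_D = {E ∈ σ : E ⊆ D}`. -/
def restrictTo {M : ℕ} (σ : Part M) (D : Finset (Fin M)) : Finset (Finset (Fin M)) :=
  {E ∈ σ.parts | E ⊆ D}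

theorem subset_of_mem_restrictTo {M : ℕ} {σ : Part M} {D E : Finset (Fin M)}
    (h : E ∈ restrictTo σ D) : E ⊆ D :=
  (mem_filter.mp h).2

/-- The half-size `𝔞 = #A / 2` of a block of even size. -/
def halfSize {M : ℕ} (A : Finset (Fin M)) : ℕ := A.card / 2

/-- `𝔫_γ(π)`: the number of blocks of `π` of cardinality `2γ`. -/
def numBlocks {M : ℕ} (π : Part M) (γ : ℕ) : ℕ := #{A ∈ π.parts | A.card = 2 * γ}

/-! ### Words and the two sums -/

/-- The `σ`-measurable words `j : [M] → [n]`: `j` is constant on the blocks of `σ`. -/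
def words {M : ℕ} (σ : Part M) (n : ℕ) : Finset (Fin M → Fin n) :=
  {j | ∀ E ∈ σ.parts, ∀ a ∈ E, ∀ b ∈ E, j a = j b}

open scoped Classical in
/-- The `σ|_B`-measurable words `j|_B = (j_α)_{α ∈ B}`. -/
def wordsOn {M : ℕ} (σ : Part M) (B : Finset (Fin M)) (n : ℕ) : Finset (B → Fin n) :=
  {j | ∀ E ∈ restrictTo σ B, ∀ a b : B, (a : Fin M) ∈ E → (b : Fin M) ∈ E → j a = j b}

/-- `∑_{j|_B σ|_B-measurable} ∏_{A ∈ π|_B} |C{Z_{j_α}}_{α ∈ A}|`. -/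
def blockSum {M : ℕ} (π σ : Part M) (B : Finset (Fin M)) (n : ℕ) : ℝ :=
  ∑ j ∈ wordsOn σ B n, ∏ A : restrictTo π B,
    ‖blockCumulant n (A : Finset (Fin M))
      (Finset.restrict₂ (π := fun _ => Fin n) (subset_of_mem_restrictTo A.2) j)‖

/-- `C_π(j) = ∏_{A ∈ π} C{Z_{j_α}}_{α ∈ A}`. -/
def partCumulant {M : ℕ} (π : Part M) {n : ℕ} (j : Fin M → Fin n) : ℂ :=
  ∏ A ∈ π.parts, blockCumulant n A (A.restrict j)

end SpearmanCumulant

end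

/-! The key input is a size estimate for cumulants: if the letters of a word on a block take `d`
distinct values, the cumulant of the corresponding `Z`'s is `O(n^{1-d})`. Cumulants are treated as
iterated directional derivatives at `0` of `X ↦ log 𝔼 exp(iX)` on the space of all random variables.
There two identities hold. Two entries `A`, `B` can be merged into `AB` at the price of products of
shorter cumulants (`cumulantList_mul_cons`), which removes repeated letters. And since `∑ᵥ g(Q_v)`
is deterministic, exchangeability expresses a cumulant with a letter of its own, up to a factor
`1/(n-d)`, by cumulants in which that letter is repeated (`cumulantList_distinct`). A double
induction gives `exists_cumulantList_bound`.

For the word sums, every block of `π` in question other than the large block `A`, of size `2m`, is a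
pair. A pair has weight `O(1)` if its letters agree and `O(1/n)` otherwise. So once one letter of a
pair is known, summing over the other costs at most a factor `2`, and a `π₁`-block costs nothing.
Only the starting values of this exploration cost powers of `n`. By a parity argument
(`exists_representatives`) at most `m` points of `A` suffice to reach all of `A`.

Split by the number of values on `A`. At least three values give `n^{-2}·n^m`, two give
`n^{-1}·n²·2^m`, and one gives `n`. As `m ≥ 3`, all are `O(n^{m-2})`. Each further block of the join
needs one free starting point and contributes a factor `n`; this is the term `#(π₁ ∨ π) - 1` in the
second part. -/

noncomputable section

namespace SpearmanCumulant

/-! ### Iterated directional derivatives -/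

section DirDeriv

open scoped ContDiff

variable {E F : Type*} [NormedAddCommGroup E] [NormedSpace ℝ E]
  [NormedAddCommGroup F] [NormedSpace ℝ F]

/-- The iterated directional derivative of `f` along the vectors of the list `l`. -/
def dirD (l : List E) (f : E → ℂ) : E → ℂ :=
  l.foldr (fun a g x => fderiv ℝ g x a) f

@[simp] theorem dirD_nil (f : E → ℂ) : dirD [] f = f := rfl

theorem dirD_cons (a : E) (l : List E) (f : E → ℂ) :
    dirD (a :: l) f = fun x => fderiv ℝ (dirD l f) x a := rfl

theorem dirD_append (l l' : List E) (f : E → ℂ) : dirD (l ++ l') f = dirD l (dirD l' f) := by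
  simp [dirD, List.foldr_append]

variable {U : Set E} {f g : E → ℂ}

theorem contDiffOn_fderiv_apply (hU : IsOpen U) (hf : ContDiffOn ℝ ∞ f U) (a : E) :
    ContDiffOn ℝ ∞ (fun x => fderiv ℝ f x a) U :=
  (hf.fderiv_of_isOpen hU (m := ∞) (by simp)).clm_apply contDiffOn_const

theorem contDiffOn_dirD (hU : IsOpen U) (hf : ContDiffOn ℝ ∞ f U) (l : List E) :
    ContDiffOn ℝ ∞ (dirD l f) U := by
  induction l with
  | nil => exact hf
  | cons a l ih => exact contDiffOn_fderiv_apply hU ih a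

theorem fderiv_eqOn (hU : IsOpen U) (h : Set.EqOn f g U) {x : E} (hx : x ∈ U) :
    fderiv ℝ f x = fderiv ℝ g x :=
  Filter.EventuallyEq.fderiv_eq (h.eventuallyEq_of_mem (hU.mem_nhds hx))

theorem dirD_eqOn (hU : IsOpen U) (h : Set.EqOn f g U) (l : List E) :
    Set.EqOn (dirD l f) (dirD l g) U := by
  induction l with
  | nil => exact h
  | cons a l ih => intro x hx; simp only [dirD_cons]; rw [fderiv_eqOn hU ih hx]

theorem differentiableAt_of_contDiffOn (hU : IsOpen U) (hf : ContDiffOn ℝ ∞ f U) {x : E}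
    (hx : x ∈ U) : DifferentiableAt ℝ f x :=
  (hf.contDiffAt (hU.mem_nhds hx)).differentiableAt (by simp)

theorem dirD_swap (hU : IsOpen U) (hf : ContDiffOn ℝ ∞ f U) (a b : E) :
    Set.EqOn (dirD [a, b] f) (dirD [b, a] f) U := by
  intro x hx
  have hc := hf.contDiffAt (hU.mem_nhds hx)
  have hs : IsSymmSndFDerivAt ℝ f x := hc.isSymmSndFDerivAt
    (by simpa using WithTop.coe_le_coe.2 (le_top : (2 : ℕ∞) ≤ ⊤))
  have hd : DifferentiableAt ℝ (fderiv ℝ f) x :=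
    (hc.fderiv_right (m := 1) (by norm_cast)).differentiableAt (by simp)
  have key : ∀ v w : E, fderiv ℝ (fun y => fderiv ℝ f y w) x v = fderiv ℝ (fderiv ℝ f) x v w := by
    intro v w
    rw [fderiv_clm_apply hd (differentiableAt_const w)]
    simp
  simp only [dirD_cons, dirD_nil]
  rw [key, key]
  exact hs.eq a b

/-- Schwarz's theorem, applied to adjacent transpositions. It is what allows lists to stand for the
unordered entries of a cumulant. -/
theorem dirD_perm (hU : IsOpen U) (hf : ContDiffOn ℝ ∞ f U) {l l' : List E} (h : l.Perm l') :
    Set.EqOn (dirD l f) (dirD l' f) U := by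
  induction h with
  | nil => exact fun _ _ => rfl
  | cons a _ ih => intro x hx; simp only [dirD_cons]; rw [fderiv_eqOn hU ih hx]
  | swap a b l => exact dirD_swap hU (contDiffOn_dirD hU hf l) b a
  | trans _ _ ih₁ ih₂ => exact ih₁.trans ih₂

/-- Moves the outermost derivative to the innermost place, so that identities for the first
derivatives of `logChar` can be differentiated further along `l`. -/
theorem dirD_cons_eqOn (hU : IsOpen U) (hf : ContDiffOn ℝ ∞ f U) (a : E) (l : List E) :
    Set.EqOn (dirD (a :: l) f) (dirD l (fun x => fderiv ℝ f x a)) U := by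
  have h := dirD_perm hU hf (List.perm_append_singleton a l).symm
  rwa [dirD_append] at h

theorem dirD_add (hU : IsOpen U) (hf : ContDiffOn ℝ ∞ f U) (hg : ContDiffOn ℝ ∞ g U)
    (l : List E) :
    Set.EqOn (dirD l (fun x => f x + g x)) (fun x => dirD l f x + dirD l g x) U := by
  induction l with
  | nil => exact fun _ _ => rfl
  | cons a l ih =>
    intro x hx
    simp only [dirD_cons]
    rw [fderiv_eqOn hU ih hx, fderiv_fun_add
      (differentiableAt_of_contDiffOn hU (contDiffOn_dirD hU hf l) hx)
      (differentiableAt_of_contDiffOn hU (contDiffOn_dirD hU hg l) hx)]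
    rfl

theorem dirD_const_mul (hU : IsOpen U) (hf : ContDiffOn ℝ ∞ f U) (c : ℂ) (l : List E) :
    Set.EqOn (dirD l (fun x => c * f x)) (fun x => c * dirD l f x) U := by
  induction l with
  | nil => exact fun _ _ => rfl
  | cons a l ih =>
    intro x hx
    simp only [dirD_cons]
    rw [fderiv_eqOn hU ih hx, fderiv_const_mul
      (differentiableAt_of_contDiffOn hU (contDiffOn_dirD hU hf l) hx)]
    rfl

theorem dirD_const (c : ℂ) {l : List E} (hl : l ≠ []) : dirD l (fun _ => c) = fun _ => 0 := by
  induction l with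
  | nil => exact absurd rfl hl
  | cons a l ih =>
    rw [dirD_cons]
    cases l with
    | nil => simp
    | cons b l => rw [ih (by simp)]; simp

/-- All ways to distribute the entries of a list over two lists. -/
def splits {α : Type*} : List α → List (List α × List α)
  | [] => [([], [])]
  | a :: l => (splits l).map (fun p => (a :: p.1, p.2)) ++ (splits l).map (fun p => (p.1, a :: p.2))

theorem length_splits {α : Type*} (l : List α) : (splits l).length = 2 ^ l.length := by
  induction l with
  | nil => rfl
  | cons a l ih => simp [splits, ih, pow_succ]; ring

theorem perm_of_mem_splits {α : Type*} {l : List α} {p : List α × List α} (h : p ∈ splits l) :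
    (p.1 ++ p.2).Perm l := by
  induction l generalizing p with
  | nil => simp [splits] at h; simp [h]
  | cons a l ih =>
    simp only [splits, List.mem_append, List.mem_map] at h
    rcases h with ⟨q, hq, rfl⟩ | ⟨q, hq, rfl⟩
    · exact (ih hq).cons a
    · exact List.perm_middle.trans ((ih hq).cons a)

theorem splits_map {α β : Type*} (f : α → β) (l : List α) :
    splits (l.map f) = (splits l).map (fun p => (p.1.map f, p.2.map f)) := by
  induction l with
  | nil => rfl
  | cons a l ih => simp [splits, ih, Function.comp_def]

theorem dirD_mul (hU : IsOpen U) (hf : ContDiffOn ℝ ∞ f U) (hg : ContDiffOn ℝ ∞ g U)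
    (l : List E) :
    Set.EqOn (dirD l (fun x => f x * g x))
      (fun x => ((splits l).map (fun p => dirD p.1 f x * dirD p.2 g x)).sum) U := by
  induction l with
  | nil => intro x _; simp [splits]
  | cons a l ih =>
    intro x hx
    simp only [dirD_cons]
    rw [fderiv_eqOn hU ih hx]
    simp only [splits, List.map_append, List.map_map, List.sum_append, Function.comp_def]
    generalize splits l = S
    have hd : ∀ p : List E × List E,
        DifferentiableAt ℝ (fun x => dirD p.1 f x * dirD p.2 g x) x := fun p =>
      (differentiableAt_of_contDiffOn hU (contDiffOn_dirD hU hf p.1) hx).mul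
        (differentiableAt_of_contDiffOn hU (contDiffOn_dirD hU hg p.2) hx)
    have key : DifferentiableAt ℝ
          (fun x => (S.map (fun p => dirD p.1 f x * dirD p.2 g x)).sum) x ∧
        fderiv ℝ (fun x => (S.map (fun p => dirD p.1 f x * dirD p.2 g x)).sum) x a =
          (S.map (fun p => dirD (a :: p.1) f x * dirD p.2 g x)).sum +
            (S.map (fun p => dirD p.1 f x * dirD (a :: p.2) g x)).sum := by
      induction S with
      | nil => simp
      | cons p S ihS =>
        simp only [List.map_cons, List.sum_cons]
        refine ⟨(hd p).add ihS.1, ?_⟩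
        rw [fderiv_fun_add (hd p) ihS.1, _root_.add_apply, ihS.2,
          fderiv_fun_mul (differentiableAt_of_contDiffOn hU (contDiffOn_dirD hU hf p.1) hx)
            (differentiableAt_of_contDiffOn hU (contDiffOn_dirD hU hg p.2) hx)]
        simp only [dirD_cons, _root_.add_apply, _root_.smul_apply,
          smul_eq_mul]
        ring
    exact key.2

theorem dirD_comp (hU : IsOpen U) (hf : ContDiffOn ℝ ∞ f U) (T : F →L[ℝ] E) (l : List F) :
    Set.EqOn (dirD l (f ∘ T)) (dirD (l.map T) f ∘ T) (T ⁻¹' U) := by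
  induction l with
  | nil => exact fun _ _ => rfl
  | cons a l ih =>
    intro x hx
    simp only [dirD_cons, List.map_cons, Function.comp_apply]
    rw [fderiv_eqOn (hU.preimage T.continuous) ih hx, fderiv_comp x
      (differentiableAt_of_contDiffOn hU (contDiffOn_dirD hU hf _) hx) T.differentiableAt]
    simp

theorem iteratedFDeriv_eq_dirD (hU : IsOpen U) (hf : ContDiffOn ℝ ∞ f U) {N : ℕ}
    (v : Fin N → E) : Set.EqOn (fun x => iteratedFDeriv ℝ N f x v) (dirD (List.ofFn v) f) U := by
  induction N with
  | zero => intro x _; simp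
  | succ N ih =>
    intro x hx
    simp only [List.ofFn_succ, dirD_cons]
    rw [← fderiv_eqOn hU (ih (fun i => v i.succ)) hx, iteratedFDeriv_succ_apply_left]
    have hd : DifferentiableAt ℝ (iteratedFDeriv ℝ N f) x :=
      (hf.contDiffAt (hU.mem_nhds hx)).differentiableAt_iteratedFDeriv
        (by exact_mod_cast WithTop.coe_lt_top _)
    have := (hd.hasFDerivAt.continuousMultilinear_apply_const (fun i => v i.succ)).fderiv
    rw [this]
    rfl

end DirDeriv

/-! ### The logarithm of the characteristic function on a finite uniform space -/

section LogChar

open scoped ContDiff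

variable {Ω : Type*} [Fintype Ω]

/-- The characteristic function `X ↦ 𝔼 exp (i X)` on the space of all random variables of a finite
uniform probability space. -/
def expChar (X : Ω → ℝ) : ℂ :=
  (Fintype.card Ω : ℂ)⁻¹ * ∑ w, Complex.exp (Complex.I * (X w : ℂ))

/-- The cumulant generating function `X ↦ log 𝔼 exp (i X)`. -/
def logChar (X : Ω → ℝ) : ℂ := Complex.log (expChar X)

/-- The domain on which `logChar` is smooth. -/
def charDomain (Ω : Type*) [Fintype Ω] : Set (Ω → ℝ) := {X | expChar X ∈ Complex.slitPlane}

/-- The derivative `𝔼 [i A exp (i X)]` of the characteristic function in the direction `A`. -/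
def expCharDeriv (A X : Ω → ℝ) : ℂ :=
  (Fintype.card Ω : ℂ)⁻¹ * ∑ w, Complex.I * (A w : ℂ) * Complex.exp (Complex.I * (X w : ℂ))

theorem contDiff_ofReal_apply (w : Ω) : ContDiff ℝ ∞ (fun X : Ω → ℝ => (X w : ℂ)) :=
  Complex.ofRealCLM.contDiff.comp (contDiff_apply ℝ ℝ w)

theorem contDiff_cexp_apply (w : Ω) :
    ContDiff ℝ ∞ (fun X : Ω → ℝ => Complex.exp (Complex.I * (X w : ℂ))) :=
  (contDiff_const.mul (contDiff_ofReal_apply w)).cexp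

theorem contDiff_expChar : ContDiff ℝ ∞ (expChar : (Ω → ℝ) → ℂ) :=
  contDiff_const.mul (ContDiff.sum fun w _ => contDiff_cexp_apply w)

theorem hasFDerivAt_cexp_apply (w : Ω) (X : Ω → ℝ) :
    HasFDerivAt (fun X : Ω → ℝ => Complex.exp (Complex.I * (X w : ℂ)))
      (Complex.exp (Complex.I * (X w : ℂ)) • Complex.I •
        Complex.ofRealCLM.comp (ContinuousLinearMap.proj (R := ℝ) (φ := fun _ : Ω => ℝ) w)) X := by
  have h : HasFDerivAt (fun X : Ω → ℝ => (X w : ℂ))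
      (Complex.ofRealCLM.comp (ContinuousLinearMap.proj (R := ℝ) (φ := fun _ : Ω => ℝ) w)) X :=
    (Complex.ofRealCLM.comp
      (ContinuousLinearMap.proj (R := ℝ) (φ := fun _ : Ω => ℝ) w)).hasFDerivAt
  exact (h.const_mul Complex.I).cexp

theorem fderiv_expChar (A X : Ω → ℝ) : fderiv ℝ expChar X A = expCharDeriv A X := by
  have h : HasFDerivAt expChar _ X :=
    (HasFDerivAt.fun_sum fun w (_ : w ∈ univ) => hasFDerivAt_cexp_apply w X).const_mul
      (Fintype.card Ω : ℂ)⁻¹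
  rw [h.fderiv]
  simp only [expCharDeriv, _root_.smul_apply, _root_.sum_apply,
    ContinuousLinearMap.comp_apply, smul_eq_mul, ContinuousLinearMap.proj_apply,
    Complex.ofRealCLM_apply]
  congr 1
  exact Finset.sum_congr rfl fun w _ => by ring

theorem fderiv_expCharDeriv (A B X : Ω → ℝ) :
    fderiv ℝ (expCharDeriv A) X B = Complex.I * expCharDeriv (A * B) X := by
  have h : HasFDerivAt (expCharDeriv A) _ X :=
    (HasFDerivAt.fun_sum fun w (_ : w ∈ univ) =>
      (hasFDerivAt_cexp_apply w X).const_mul (Complex.I * (A w : ℂ))).const_mul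
      (Fintype.card Ω : ℂ)⁻¹
  rw [h.fderiv]
  simp only [expCharDeriv, _root_.smul_apply, _root_.sum_apply,
    ContinuousLinearMap.comp_apply, smul_eq_mul, ContinuousLinearMap.proj_apply,
    Complex.ofRealCLM_apply]
  rw [mul_left_comm, Finset.mul_sum (a := Complex.I)]
  congr 1
  exact Finset.sum_congr rfl fun w _ => by simp only [Pi.mul_apply, Complex.ofReal_mul]; ring

theorem isOpen_charDomain : IsOpen (charDomain Ω) :=
  Complex.isOpen_slitPlane.preimage contDiff_expChar.continuous

theorem expChar_zero [Nonempty Ω] : expChar (0 : Ω → ℝ) = 1 := by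
  simp [expChar]

theorem zero_mem_charDomain [Nonempty Ω] : (0 : Ω → ℝ) ∈ charDomain Ω := by
  simp [charDomain, expChar_zero]

theorem contDiffOn_logChar : ContDiffOn ℝ ∞ (logChar : (Ω → ℝ) → ℂ) (charDomain Ω) :=
  fun X hX => ((Complex.contDiffAt_log hX).restrict_scalars ℝ |>.comp X
    contDiff_expChar.contDiffAt).contDiffWithinAt

theorem expChar_ne_zero {X : Ω → ℝ} (hX : X ∈ charDomain Ω) : expChar X ≠ 0 :=
  Complex.slitPlane_ne_zero hX

theorem differentiableAt_logChar {X : Ω → ℝ} (hX : X ∈ charDomain Ω) :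
    DifferentiableAt ℝ (logChar : (Ω → ℝ) → ℂ) X :=
  differentiableAt_of_contDiffOn isOpen_charDomain contDiffOn_logChar hX

theorem expCharDeriv_eq {X : Ω → ℝ} (hX : X ∈ charDomain Ω) (A : Ω → ℝ) :
    expCharDeriv A X = expChar X * fderiv ℝ logChar X A := by
  have e : Set.EqOn (expChar : (Ω → ℝ) → ℂ) (fun Y => Complex.exp (logChar Y)) (charDomain Ω) :=
    fun Y hY => (Complex.exp_log (expChar_ne_zero hY)).symm
  rw [← fderiv_expChar, fderiv_eqOn isOpen_charDomain e hX,
    (differentiableAt_logChar hX).hasFDerivAt.cexp.fderiv, _root_.smul_apply, smul_eq_mul,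
    logChar, Complex.exp_log (expChar_ne_zero hX)]

/-- Differentiating `𝔼[iA exp(iX)]` in the direction `B` gives `i` times the same expression for
`AB`. Writing each such expectation as `expChar` times a derivative of `logChar` and dividing by
`expChar` gives the rule. -/
theorem logChar_product_rule (A B : Ω → ℝ) :
    Set.EqOn (fun X => fderiv ℝ (fun Y => fderiv ℝ logChar Y A) X B)
      (fun X => Complex.I * fderiv ℝ logChar X (A * B) +
        (-1) * (fderiv ℝ logChar X A * fderiv ℝ logChar X B)) (charDomain Ω) := by
  intro X hX
  have e : Set.EqOn (expCharDeriv A) (fun Y => expChar Y * fderiv ℝ logChar Y A) (charDomain Ω) :=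
    fun Y hY => expCharDeriv_eq hY A
  have h := fderiv_expCharDeriv A B X
  rw [fderiv_eqOn isOpen_charDomain e hX, fderiv_fun_mul
    (contDiff_expChar.differentiable (by simp) X)
    (differentiableAt_of_contDiffOn isOpen_charDomain
      (contDiffOn_fderiv_apply isOpen_charDomain contDiffOn_logChar A) hX)] at h
  simp only [_root_.add_apply, _root_.smul_apply, smul_eq_mul, fderiv_expChar,
    expCharDeriv_eq hX] at h
  apply mul_left_cancel₀ (expChar_ne_zero hX)
  linear_combination h

/-- This derivative does not depend on `X`, so every further derivative vanishes: a cumulant of at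
least two entries, one of them deterministic, is zero. -/
theorem fderiv_logChar_const {X : Ω → ℝ} (hX : X ∈ charDomain Ω) (c : ℝ) :
    fderiv ℝ logChar X (fun _ => c) = Complex.I * c := by
  apply mul_left_cancel₀ (expChar_ne_zero hX)
  rw [← expCharDeriv_eq hX]
  simp only [expCharDeriv, expChar, ← Finset.mul_sum]
  ring

theorem norm_fderiv_logChar_zero_le [Nonempty Ω] {A : Ω → ℝ} {R : ℝ} (hA : ∀ w, |A w| ≤ R) :
    ‖fderiv ℝ logChar 0 A‖ ≤ R := by
  have h := expCharDeriv_eq zero_mem_charDomain A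
  rw [expChar_zero, one_mul] at h
  rw [← h, expCharDeriv, norm_mul, norm_inv, Complex.norm_natCast]
  have h1 : ‖∑ w, Complex.I * (A w : ℂ) * Complex.exp (Complex.I * ((0 : Ω → ℝ) w : ℂ))‖ ≤
      ∑ _w : Ω, R :=
    norm_sum_le_of_le _ fun w _ => by simpa using hA w
  rw [Finset.sum_const, Finset.card_univ, nsmul_eq_mul] at h1
  rw [inv_mul_le_iff₀ (by exact_mod_cast Fintype.card_pos)]
  exact h1

/-- The joint cumulant of the entries of `l`, up to a power of the imaginary unit. -/
def cumulantList (l : List (Ω → ℝ)) : ℂ := dirD l logChar 0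

theorem cumulantList_perm [Nonempty Ω] {l l' : List (Ω → ℝ)} (h : l.Perm l') :
    cumulantList l = cumulantList l' :=
  dirD_perm isOpen_charDomain contDiffOn_logChar h zero_mem_charDomain

theorem cumulantList_sum_cons {ι : Type*} (s : Finset ι) (A : ι → Ω → ℝ) (l : List (Ω → ℝ)) :
    cumulantList ((∑ i ∈ s, A i) :: l) = ∑ i ∈ s, cumulantList (A i :: l) := by
  simp [cumulantList, dirD_cons]

theorem cumulantList_const_cons [Nonempty Ω] (c : ℝ) {l : List (Ω → ℝ)} (hl : l ≠ []) :
    cumulantList ((fun _ => c) :: l) = 0 := by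
  rw [cumulantList, dirD_cons_eqOn isOpen_charDomain contDiffOn_logChar _ _ zero_mem_charDomain,
    dirD_eqOn isOpen_charDomain (g := fun _ => Complex.I * c)
      (fun X hX => fderiv_logChar_const hX c) l zero_mem_charDomain, dirD_const _ hl]

/-- The product rule for `logChar`, differentiated along `l` by Leibniz. Read from left to right it
merges two entries into one, leaving only products of cumulants that are each shorter than the
original. -/
theorem cumulantList_mul_cons [Nonempty Ω] (A B : Ω → ℝ) (l : List (Ω → ℝ)) :
    cumulantList (B :: A :: l) = Complex.I * cumulantList ((A * B) :: l) -
      ((splits l).map fun p => cumulantList (A :: p.1) * cumulantList (B :: p.2)).sum := by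
  have hs : ∀ C : Ω → ℝ, ContDiffOn ℝ ∞ (fun X => fderiv ℝ logChar X C) (charDomain Ω) :=
    contDiffOn_fderiv_apply isOpen_charDomain contDiffOn_logChar
  have hc : ∀ (C : Ω → ℝ) (u : List (Ω → ℝ)),
      cumulantList (C :: u) = dirD u (fun X => fderiv ℝ logChar X C) 0 := fun C u =>
    dirD_cons_eqOn isOpen_charDomain contDiffOn_logChar C u zero_mem_charDomain
  have h1 : cumulantList (B :: A :: l) =
      dirD l (fun X => fderiv ℝ (fun Y => fderiv ℝ logChar Y A) X B) 0 := by
    have h := dirD_perm isOpen_charDomain contDiffOn_logChar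
      (List.perm_append_comm (l₁ := [B, A]) (l₂ := l)) (zero_mem_charDomain (Ω := Ω))
    rw [dirD_append l] at h
    exact h
  rw [h1, dirD_eqOn isOpen_charDomain (logChar_product_rule A B) l zero_mem_charDomain,
    dirD_add isOpen_charDomain (contDiffOn_const.mul (hs _))
      (contDiffOn_const.mul ((hs A).mul (hs B))) l zero_mem_charDomain]
  simp only
  rw [dirD_const_mul isOpen_charDomain (hs _) _ l zero_mem_charDomain,
    dirD_const_mul isOpen_charDomain ((hs A).mul (hs B)) _ l zero_mem_charDomain]
  simp only
  rw [dirD_mul isOpen_charDomain (hs A) (hs B) l zero_mem_charDomain, ← hc]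
  simp only [← hc]
  ring

/-- Relabelling the sample space preserves the uniform law, so `logChar` is invariant under the
induced linear map, which fixes `0`. -/
theorem cumulantList_comp_equiv [Nonempty Ω] (e : Ω ≃ Ω) (l : List (Ω → ℝ)) :
    cumulantList (l.map (fun X => X ∘ e)) = cumulantList l := by
  let T : (Ω → ℝ) →L[ℝ] (Ω → ℝ) :=
    ContinuousLinearMap.pi fun w => ContinuousLinearMap.proj (R := ℝ) (φ := fun _ : Ω => ℝ) (e w)
  have hT : ∀ X, T X = X ∘ e := fun X => rfl
  have hφ : ∀ X, logChar (T X) = logChar X := by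
    intro X
    rw [logChar, logChar, hT, expChar, expChar]
    congr 2
    exact Equiv.sum_comp e (fun w => Complex.exp (Complex.I * (X w : ℂ)))
  have h := dirD_comp isOpen_charDomain contDiffOn_logChar T l
    (x := 0) (by rw [Set.mem_preimage, map_zero]; exact zero_mem_charDomain)
  have h2 : (logChar : (Ω → ℝ) → ℂ) ∘ T = logChar := funext hφ
  rw [h2, Function.comp_apply, map_zero] at h
  exact h.symm

end LogChar

/-! ### Joint cumulants as directional derivatives of the cumulant generating function -/

section Link

theorem integral_permMeasure (n : ℕ) (f : Equiv.Perm (Fin n) → ℂ) :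
    ∫ q, f q ∂(permMeasure n) =
      (Fintype.card (Equiv.Perm (Fin n)) : ℂ)⁻¹ * ∑ q, f q := by
  have hp : IsProbabilityMeasure (permMeasure n) :=
    isProbabilityMeasure_uniformOn Set.finite_univ Set.univ_nonempty
  rw [integral_fintype (Integrable.of_finite), Finset.mul_sum]
  refine Finset.sum_congr rfl fun q _ => ?_
  rw [permMeasure, measureReal_def, uniformOn_univ, Measure.count_singleton]
  simp

/-- The generating function in the definition is `logChar` composed with the linear map `x ↦ ∑ xⱼ
ξⱼ`, which sends the `j`-th basis vector to `ξⱼ`. The prefactor has modulus one. -/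
theorem norm_jointCumulant_eq (n N : ℕ) (ξ : Fin N → Equiv.Perm (Fin n) → ℝ) :
    ‖jointCumulant (permMeasure n) ξ‖ = ‖cumulantList (List.ofFn ξ)‖ := by
  let T : (Fin N → ℝ) →L[ℝ] (Equiv.Perm (Fin n) → ℝ) :=
    LinearMap.toContinuousLinearMap (Fintype.linearCombination ℝ ξ)
  have hT : ∀ x, T x = ∑ j, x j • ξ j := fun x => rfl
  have hG : (fun x : Fin N → ℝ => Complex.log (∫ w, Complex.exp
      (∑ j, Complex.I * (x j : ℂ) * (ξ j w : ℂ)) ∂(permMeasure n))) = logChar ∘ T := by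
    funext x
    rw [integral_permMeasure, Function.comp_apply, logChar, expChar, hT]
    congr 2
    refine Finset.sum_congr rfl fun q _ => ?_
    congr 1
    simp only [Finset.sum_apply, Pi.smul_apply, smul_eq_mul, Complex.ofReal_sum,
      Complex.ofReal_mul, Finset.mul_sum, mul_assoc]
  have hU := (isOpen_charDomain (Ω := Equiv.Perm (Fin n))).preimage T.continuous
  have h0 : (0 : Fin N → ℝ) ∈ T ⁻¹' charDomain (Equiv.Perm (Fin n)) := by
    rw [Set.mem_preimage, map_zero]; exact zero_mem_charDomain
  rw [jointCumulant, hG, norm_mul, norm_inv, norm_pow, Complex.norm_I, one_pow, inv_one, one_mul]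
  have h := iteratedFDeriv_eq_dirD hU (contDiffOn_logChar.comp T.contDiff.contDiffOn
    (Set.mapsTo_preimage _ _)) (fun j : Fin N => Pi.single j (1 : ℝ)) h0
  simp only at h
  rw [h, dirD_comp isOpen_charDomain contDiffOn_logChar T _ h0, Function.comp_apply, map_zero,
    List.map_ofFn, cumulantList]
  congr 3
  have : (⇑T ∘ fun j => Pi.single j (1 : ℝ)) = ξ := by
    funext j
    rw [Function.comp_apply, hT]
    simp [Pi.single_apply, ite_smul]
  rw [this]

end Link

/-! ### Size of cumulants of a random permutation by the number of distinct letters -/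

section CumulantBound

variable {n : ℕ}

/-- The random variable `q ↦ g (q i)` attached to a letter `i` and a function `g`. -/
def letterVar (p : Fin n × (Fin n → ℝ)) (q : Equiv.Perm (Fin n)) : ℝ := p.2 (q p.1)

/-- The letters that occur in a list of pairs (letter, function). -/
def letters (l : List (Fin n × (Fin n → ℝ))) : Finset (Fin n) := (l.map Prod.fst).toFinset

theorem letters_cons (p : Fin n × (Fin n → ℝ)) (l : List (Fin n × (Fin n → ℝ))) :
    letters (p :: l) = insert p.1 (letters l) := by simp [letters]

theorem letters_perm {l l' : List (Fin n × (Fin n → ℝ))} (h : l.Perm l') :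
    letters l = letters l' := List.toFinset_eq_of_perm _ _ (h.map _)

theorem letters_append (l l' : List (Fin n × (Fin n → ℝ))) :
    letters (l ++ l') = letters l ∪ letters l' := by simp [letters]

/-- Exchangeability: right multiplication by the transposition of `i` and `v` preserves the uniform
law and leaves the entries of `l` unchanged. -/
theorem cumulantList_eq_of_letter_notMem (g : Fin n → ℝ) {i v : Fin n}
    {l : List (Fin n × (Fin n → ℝ))} (hi : i ∉ letters l) (hv : v ∉ letters l) :
    cumulantList (((v, g) :: l).map letterVar) = cumulantList (((i, g) :: l).map letterVar) := by
  rw [← cumulantList_comp_equiv (Equiv.mulRight (Equiv.swap i v)) (((i, g) :: l).map letterVar)]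
  congr 1
  rw [List.map_map, List.map_cons, List.map_cons]
  congr 1
  · funext q
    simp [letterVar]
  · refine List.map_congr_left fun p hp => ?_
    have hp' : p.1 ∈ letters l := by simpa [letters] using ⟨p.2, hp⟩
    funext q
    simp only [Function.comp_apply, letterVar, Equiv.coe_mulRight, Equiv.Perm.coe_mul]
    rw [Equiv.swap_apply_of_ne_of_ne (ne_of_mem_of_not_mem hp' hi)
      (ne_of_mem_of_not_mem hp' hv)]

theorem sum_letterVar (g : Fin n → ℝ) :
    ∑ v, letterVar (v, g) = fun _ : Equiv.Perm (Fin n) => ∑ v, g v := by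
  funext q
  rw [Finset.sum_apply]
  exact Equiv.sum_comp q g

/-- A cumulant of pairwise distinct entries, expressed through cumulants with fewer letters. -/
theorem cumulantList_distinct (g : Fin n → ℝ) {i : Fin n} {l : List (Fin n × (Fin n → ℝ))}
    (hl : l ≠ []) (hi : i ∉ letters l) :
    ((n : ℂ) - (letters l).card) * cumulantList (((i, g) :: l).map letterVar) =
      -∑ v ∈ letters l, cumulantList (((v, g) :: l).map letterVar) := by
  -- The sum over all `n` letters `v` of the cumulant with first entry `g(Q_v)` is zero. The letters
  -- outside `l` contribute equal terms, and there are `n - #(letters l)` of them.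
  have h := cumulantList_const_cons (Ω := Equiv.Perm (Fin n)) (∑ v, g v)
    (l := l.map letterVar) (by simpa using hl)
  rw [← sum_letterVar, cumulantList_sum_cons, ← Finset.sum_add_sum_compl (letters l)] at h
  have h2 : ∑ v ∈ (letters l)ᶜ, cumulantList (letterVar (v, g) :: l.map letterVar) =
      ∑ _v ∈ (letters l)ᶜ, cumulantList (((i, g) :: l).map letterVar) :=
    Finset.sum_congr rfl fun v hv =>
      cumulantList_eq_of_letter_notMem g hi (by simpa using hv)
  rw [h2, Finset.sum_const, nsmul_eq_mul, Finset.card_compl, Fintype.card_fin,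
    Nat.cast_sub (by simpa using Finset.card_le_univ (letters l))] at h
  simp only [List.map_cons] at h ⊢
  linear_combination h

theorem exists_perm_of_letters_lt {l : List (Fin n × (Fin n → ℝ))}
    (h : (letters l).card < l.length) :
    ∃ i g g' l', l.Perm ((i, g) :: (i, g') :: l') := by
  classical
  induction l with
  | nil => simp at h
  | cons p l ih =>
    by_cases hp : p.1 ∈ letters l
    · obtain ⟨g', hg'⟩ : ∃ g', (p.1, g') ∈ l := by simpa [letters] using hp
      exact ⟨p.1, p.2, g', _, (List.perm_cons_erase hg').cons p⟩
    · rw [letters_cons, Finset.card_insert_of_notMem hp, List.length_cons] at h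
      obtain ⟨i, g, g', l', hl'⟩ := ih (by omega)
      refine ⟨i, g, g', p :: l', (hl'.cons p).trans ?_⟩
      exact (List.Perm.swap _ _ _).trans ((List.Perm.swap _ _ _).cons _)

theorem card_letters_le (l : List (Fin n × (Fin n → ℝ))) : (letters l).card ≤ l.length := by
  simpa [letters] using List.toFinset_card_le (l.map Prod.fst)

theorem letters_nonempty {l : List (Fin n × (Fin n → ℝ))} (hl : l ≠ []) :
    (letters l).Nonempty := by
  cases l with
  | nil => exact absurd rfl hl
  | cons p l => rw [letters_cons]; exact Finset.insert_nonempty _ _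

theorem norm_list_sum_le {α : Type*} (S : List α) (f : α → ℂ) {c : ℝ}
    (h : ∀ a ∈ S, ‖f a‖ ≤ c) : ‖(S.map f).sum‖ ≤ S.length * c := by
  induction S with
  | nil => simp
  | cons a S ih =>
    rw [List.map_cons, List.sum_cons, List.length_cons, Nat.cast_succ, add_one_mul, add_comm]
    exact (norm_add_le _ _).trans
      (add_le_add (ih fun b hb => h b (List.mem_cons_of_mem _ hb)) (h a List.mem_cons_self))

/-- In orders of magnitude: `m^{1-a} · m^{1-b} ≤ m^{1-d}` as soon as `a + b ≥ d + 1`. -/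
theorem mul_pow_le_of_split {x y K m : ℝ} {a b d : ℕ} (hm : 1 ≤ m) (hy : 0 ≤ y)
    (hx : 0 ≤ x) (hxa : x * m ^ a ≤ K * m) (hyb : y * m ^ b ≤ K * m) (hd : d + 1 ≤ a + b) :
    x * y * m ^ d ≤ K * K * m := by
  have hm0 : 0 < m := by linarith
  have h1 : (x * m ^ a) * (y * m ^ b) ≤ (K * m) * (K * m) :=
    mul_le_mul hxa hyb (by positivity) (le_trans (by positivity) hxa)
  have h2 : m ^ (d + 1) ≤ m ^ (a + b) := pow_le_pow_right₀ hm hd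
  have h3 : (x * y) * m ^ (d + 1) ≤ (x * y) * m ^ (a + b) :=
    mul_le_mul_of_nonneg_left h2 (by positivity)
  rw [pow_succ] at h3
  rw [pow_add] at h3
  nlinarith

/-- Merging the two entries with letter `i` keeps the set of letters and shortens the list. The new
function `g' * g` is bounded by `R * R`, which is why `K₂` refers to a larger bound on the
functions. The factor `2 ^ N` bounds the number of splits of `l`. -/
theorem norm_cumulantList_repeated_le {N : ℕ} {R K₁ K₂ : ℝ} {i : Fin n} {g g' : Fin n → ℝ}
    {l : List (Fin n × (Fin n → ℝ))} {d : ℕ} (hR : 0 ≤ R)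
    (hlen : l.length + 1 ≤ N) (hd : (letters ((i, g) :: l)).card = d)
    (hK₁ : ∀ l : List (Fin n × (Fin n → ℝ)), l ≠ [] → l.length ≤ N → (letters l).card ≤ d →
      (∀ p ∈ l, ∀ v, |p.2 v| ≤ R) →
      ‖cumulantList (l.map letterVar)‖ * (n : ℝ) ^ (letters l).card ≤ K₁ * n)
    (hK₂ : ∀ l : List (Fin n × (Fin n → ℝ)), l ≠ [] → l.length ≤ N → (letters l).card ≤ d →
      (∀ p ∈ l, ∀ v, |p.2 v| ≤ max R (R * R)) →
      ‖cumulantList (l.map letterVar)‖ * (n : ℝ) ^ (letters l).card ≤ K₂ * n)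
    (hg : ∀ v, |g v| ≤ R) (hg' : ∀ v, |g' v| ≤ R) (hl : ∀ p ∈ l, ∀ v, |p.2 v| ≤ R) :
    ‖cumulantList (((i, g) :: (i, g') :: l).map letterVar)‖ * (n : ℝ) ^ d ≤
      (K₂ + 2 ^ N * (K₁ * K₁)) * n := by
  have hn : (1 : ℝ) ≤ n := by
    have := i.2
    exact_mod_cast (by omega : 1 ≤ n)
  have hl1 : ∀ h : Fin n → ℝ, letters ((i, h) :: l) = letters ((i, g) :: l) := fun h => by
    rw [letters_cons, letters_cons]
  have e : letterVar (i, g') * letterVar (i, g) = letterVar (i, g' * g) := rfl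
  rw [List.map_cons, List.map_cons, cumulantList_mul_cons, e, splits_map, List.map_map]
  have h1 : ‖cumulantList (((i, g' * g) :: l).map letterVar)‖ * (n : ℝ) ^ d ≤ K₂ * n := by
    rw [← hd, ← hl1 (g' * g)]
    refine hK₂ _ (by simp) (by simpa using hlen) (by rw [hl1, hd]) ?_
    intro p hp v
    rcases List.mem_cons.1 hp with rfl | hp
    · refine le_trans ?_ (le_max_right _ _)
      simp only [Pi.mul_apply, abs_mul]
      exact mul_le_mul (hg' v) (hg v) (abs_nonneg _) hR
    · exact (hl p hp v).trans (le_max_left _ _)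
  have h2 : ∀ p ∈ splits l,
      ‖cumulantList (letterVar (i, g') :: p.1.map letterVar) *
        cumulantList (letterVar (i, g) :: p.2.map letterVar)‖ ≤ K₁ * K₁ * n / (n : ℝ) ^ d := by
    intro p hp
    have hperm := perm_of_mem_splits hp
    have hlen' := hperm.length_eq
    rw [List.length_append] at hlen'
    have hlet : letters p.1 ∪ letters p.2 = letters l := by
      rw [← letters_append, letters_perm hperm]
    have hsub₁ : letters p.1 ⊆ letters l := hlet ▸ Finset.subset_union_left
    have hsub₂ : letters p.2 ⊆ letters l := hlet ▸ Finset.subset_union_right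
    have hmem : ∀ q, q ∈ p.1 ∨ q ∈ p.2 → q ∈ l := fun q hq =>
      hperm.subset (List.mem_append.2 hq)
    rw [le_div_iff₀ (by positivity), norm_mul]
    refine mul_pow_le_of_split hn (norm_nonneg _) (norm_nonneg _)
      (hK₁ ((i, g') :: p.1) (by simp) (by simp; omega) ?_ ?_)
      (hK₁ ((i, g) :: p.2) (by simp) (by simp; omega) ?_ ?_) ?_
    · rw [← hd, letters_cons, letters_cons]
      exact Finset.card_le_card (Finset.insert_subset_insert _ hsub₁)
    · intro q hq
      rcases List.mem_cons.1 hq with rfl | hq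
      exacts [hg', hl q (hmem q (Or.inl hq))]
    · rw [← hd, letters_cons, letters_cons]
      exact Finset.card_le_card (Finset.insert_subset_insert _ hsub₂)
    · intro q hq
      rcases List.mem_cons.1 hq with rfl | hq
      exacts [hg, hl q (hmem q (Or.inr hq))]
    -- Both factors contain the letter `i`, so it is counted twice and the two letter counts add up
    -- to at least `d + 1`.
    · rw [letters_cons, letters_cons, ← Finset.card_union_add_card_inter, ← hd, letters_cons]
      apply Nat.add_le_add
      · apply Finset.card_le_card
        rw [← hlet]
        intro v
        simp only [Finset.mem_insert, Finset.mem_union]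
        tauto
      · exact Finset.card_pos.2 ⟨i, by simp⟩
  have h3 := norm_list_sum_le (splits l) _ h2
  rw [length_splits, ← mul_div_assoc, le_div_iff₀ (by positivity)] at h3
  have h4 : ((2 ^ l.length : ℕ) : ℝ) * (K₁ * K₁ * n) ≤ 2 ^ N * (K₁ * K₁ * n) := by
    push_cast
    exact mul_le_mul_of_nonneg_right (pow_le_pow_right₀ (by norm_num) (by omega))
      (mul_nonneg (mul_self_nonneg _) (by linarith))
  refine (mul_le_mul_of_nonneg_right (norm_sub_le _ _) (by positivity)).trans ?_
  rw [norm_mul, Complex.norm_I, one_mul, add_mul]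
  simp only [Function.comp_def, List.map_cons] at h1 h3 ⊢
  linarith

/-- The new letter `i` is traded for the `d` letters already in `l`; dividing by `n - d` supplies
the extra factor `1/n`. The term `R` covers empty `l`, where the cumulant is a mean. -/
theorem norm_cumulantList_distinct_le {R K : ℝ} {i : Fin n} {g : Fin n → ℝ}
    {l : List (Fin n × (Fin n → ℝ))} {d : ℕ} (hR : 0 ≤ R)
    (hi : i ∉ letters l) (hd : (letters l).card = d)
    (hK : ∀ v ∈ letters l, ‖cumulantList (((v, g) :: l).map letterVar)‖ * (n : ℝ) ^ d ≤ K * n)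
    (hg : ∀ v, |g v| ≤ R) :
    ‖cumulantList (((i, g) :: l).map letterVar)‖ * (n : ℝ) ^ (d + 1) ≤
      (R + (d + 1) * (d * K)) * n := by
  have hn0 : (0 : ℝ) ≤ n := Nat.cast_nonneg n
  by_cases hl : l = []
  · subst hl
    have hd0 : d = 0 := by simpa [letters] using hd.symm
    subst hd0
    have := norm_fderiv_logChar_zero_le (A := letterVar (i, g)) (R := R) fun q => hg _
    have h2 : cumulantList (([(i, g)] : List _).map letterVar) =
      fderiv ℝ logChar 0 (letterVar (i, g)) := rfl
    rw [h2]
    simpa using mul_le_mul_of_nonneg_right this hn0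
  · have h := congrArg norm (cumulantList_distinct g hl hi)
    have hdn : d + 1 ≤ n := by
      rw [← hd, ← Finset.card_insert_of_notMem hi]
      simpa using Finset.card_le_univ (insert i (letters l))
    have hdn' : (d : ℝ) + 1 ≤ n := by exact_mod_cast hdn
    have hd0 : (0 : ℝ) ≤ d := Nat.cast_nonneg d
    have e : ((n : ℂ) - (d : ℂ)) = (((n : ℝ) - d : ℝ) : ℂ) := by push_cast; rfl
    rw [norm_mul, norm_neg, hd, e, Complex.norm_real, Real.norm_of_nonneg (by linarith)] at h
    have h2 : ‖∑ v ∈ letters l, cumulantList (((v, g) :: l).map letterVar)‖ * (n : ℝ) ^ d ≤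
        d * (K * n) := by
      refine (mul_le_mul_of_nonneg_right (norm_sum_le _ _) (by positivity)).trans ?_
      rw [Finset.sum_mul]
      refine (Finset.sum_le_sum hK).trans ?_
      rw [Finset.sum_const, hd, nsmul_eq_mul]
    rw [← h] at h2
    -- The difference of the two sides is `d (n - d - 1) ≥ 0`, so `1/(n - d)` may be replaced by `(d
    -- + 1)/n` uniformly in `n`.
    have h3 : (n : ℝ) ≤ (d + 1) * (n - d) := by nlinarith
    set x := ‖cumulantList (((i, g) :: l).map letterVar)‖
    have hx : 0 ≤ x * (n : ℝ) ^ d := by positivity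
    calc x * (n : ℝ) ^ (d + 1) = (x * (n : ℝ) ^ d) * n := by ring
      _ ≤ (x * (n : ℝ) ^ d) * ((d + 1) * (n - d)) := mul_le_mul_of_nonneg_left h3 hx
      _ = (d + 1) * ((n - d) * x * (n : ℝ) ^ d) := by ring
      _ ≤ (d + 1) * (d * (K * n)) := mul_le_mul_of_nonneg_left h2 (by linarith)
      _ ≤ _ := by nlinarith [mul_nonneg hR hn0]

/-- A cumulant whose entries involve `d` distinct letters is `O(n^{1 - d})`. -/
theorem exists_cumulantList_bound (d : ℕ) : ∀ (N : ℕ) (R : ℝ), 0 ≤ R → ∃ K : ℝ, 0 ≤ K ∧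
    ∀ (n : ℕ) (l : List (Fin n × (Fin n → ℝ))), l ≠ [] → l.length ≤ N → (letters l).card ≤ d →
      (∀ p ∈ l, ∀ v, |p.2 v| ≤ R) →
      ‖cumulantList (l.map letterVar)‖ * (n : ℝ) ^ (letters l).card ≤ K * n := by
  -- The outer induction is on the number of letters, the inner one on the length, with `R` left
  -- free. A repeated letter lowers the length; a list without repetitions is reduced to lists of
  -- the same length with one letter fewer.
  induction d with
  | zero =>
    refine fun N R _ => ⟨0, le_rfl, fun n l hl _ hd _ => ?_⟩
    have := (letters_nonempty hl).card_pos
    omega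
  | succ d ihd =>
    intro N
    induction N with
    | zero =>
      refine fun R _ => ⟨0, le_rfl, fun n l hl hlen _ _ => ?_⟩
      exact absurd (List.length_eq_zero_iff.1 (Nat.le_zero.1 hlen)) hl
    | succ N ihN =>
      intro R hR
      obtain ⟨K₁, hK₁0, hK₁⟩ := ihN R hR
      obtain ⟨K₂, hK₂0, hK₂⟩ := ihN (max R (R * R)) (le_max_of_le_left hR)
      obtain ⟨K₃, hK₃0, hK₃⟩ := ihd (N + 1) R hR
      refine ⟨K₃ + (K₂ + 2 ^ N * (K₁ * K₁)) + (R + (d + 1) * (d * K₃)), by positivity,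
        fun n l hl hlen hd hb => ?_⟩
      have hn0 : (0 : ℝ) ≤ n := Nat.cast_nonneg n
      have hA : 0 ≤ K₃ * n := by positivity
      have hB : 0 ≤ (K₂ + 2 ^ N * (K₁ * K₁)) * n := by positivity
      have hC : 0 ≤ (R + (d + 1) * (d * K₃)) * n := by positivity
      rw [add_mul, add_mul]
      rcases Nat.lt_or_ge (letters l).card (d + 1) with hlt | hge
      · have := hK₃ n l hl hlen (by omega) hb
        linarith
      have hd' : (letters l).card = d + 1 := le_antisymm hd hge
      rcases Nat.lt_or_ge (letters l).card l.length with hdup | hnodup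
      · obtain ⟨i, g, g', l', hperm⟩ := exists_perm_of_letters_lt hdup
        have hlen' := hperm.length_eq
        simp only [List.length_cons] at hlen'
        have hb' : ∀ p ∈ (i, g) :: (i, g') :: l', ∀ v, |p.2 v| ≤ R := fun p hp =>
          hb p (hperm.symm.subset hp)
        have hlet : (letters ((i, g) :: l')).card = d + 1 := by
          rw [← hd', letters_perm hperm]
          simp [letters_cons]
        have := norm_cumulantList_repeated_le (N := N) hR (by omega) hlet (hK₁ n) (hK₂ n)
          (hb' (i, g) (by simp)) (hb' (i, g') (by simp)) (fun p hp => hb' p (by simp [hp]))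
        rw [cumulantList_perm (hperm.map letterVar), hd']
        linarith
      · obtain ⟨⟨i, g⟩, l', rfl⟩ := List.exists_cons_of_ne_nil hl
        have hcl := card_letters_le l'
        rw [List.length_cons] at hnodup hlen
        have hi : i ∉ letters l' := by
          intro hi
          rw [letters_cons, Finset.insert_eq_of_mem hi] at hnodup
          omega
        have hd'' : (letters l').card = d := by
          rw [letters_cons, Finset.card_insert_of_notMem hi] at hd'
          omega
        have := norm_cumulantList_distinct_le (g := g) hR hi hd'' (fun v hv => by
          have hv' : letters ((v, g) :: l') = letters l' := by
            rw [letters_cons, Finset.insert_eq_of_mem hv]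
          have := hK₃ n ((v, g) :: l') (by simp) (by simpa using hlen) (by rw [hv', hd'']) (by
            intro p hp
            rcases List.mem_cons.1 hp with rfl | hp
            exacts [hb (i, g) (by simp), hb p (by simp [hp])])
          rwa [hv', hd''] at this) (hb (i, g) (by simp))
        rw [hd']
        linarith

/-- The function of the rank through which `Z n i` depends on the permutation. -/
def rankFun (n : ℕ) (v : Fin n) : ℝ :=
  Real.sqrt (12 / ((n : ℝ) ^ 2 - 1)) * ((((v : ℕ) : ℝ) + 1) - ((n : ℝ) + 1) / 2)

/-- The largest square is `3 (n - 1)/(n + 1)`, which is below `4`. -/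
theorem abs_rankFun_le (hn : 2 ≤ n) (v : Fin n) : |rankFun n v| ≤ 2 := by
  have hn' : (2 : ℝ) ≤ n := by exact_mod_cast hn
  have hv : ((v : ℕ) : ℝ) + 1 ≤ n := by exact_mod_cast v.2
  have hv0 : (0 : ℝ) ≤ ((v : ℕ) : ℝ) := Nat.cast_nonneg _
  have hpos : (0 : ℝ) < (n : ℝ) ^ 2 - 1 := by nlinarith
  apply abs_le_of_sq_le_sq _ (by norm_num)
  rw [rankFun, mul_pow, Real.sq_sqrt (by positivity), div_mul_eq_mul_div, div_le_iff₀ hpos]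
  have : ((((v : ℕ) : ℝ) + 1) - ((n : ℝ) + 1) / 2) ^ 2 ≤ (((n : ℝ) - 1) / 2) ^ 2 := by
    apply sq_le_sq' <;> linarith
  nlinarith

theorem exists_blockCumulant_bound {M : ℕ} (A : Finset (Fin M)) (hA : A.Nonempty) :
    ∃ K : ℝ, 0 ≤ K ∧ ∀ n : ℕ, 2 ≤ n → ∀ j : Fin M → Fin n,
      ‖blockCumulant n A (A.restrict j)‖ * (n : ℝ) ^ (A.image j).card ≤ K * n := by
  obtain ⟨K, hK0, hK⟩ := exists_cumulantList_bound A.card A.card 2 (by norm_num)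
  refine ⟨K, hK0, fun n hn j => ?_⟩
  let l : List (Fin n × (Fin n → ℝ)) :=
    List.ofFn fun i : Fin A.card => (j (A.orderIsoOfFin rfl i), rankFun n)
  have hlet : letters l = A.image j := by
    ext v
    simp only [letters, l, List.map_ofFn, List.mem_toFinset, List.mem_ofFn, Finset.mem_image,
      Function.comp_apply]
    constructor
    · rintro ⟨i, rfl⟩
      exact ⟨_, (A.orderIsoOfFin rfl i).2, rfl⟩
    · rintro ⟨a, ha, rfl⟩
      exact ⟨(A.orderIsoOfFin rfl).symm ⟨a, ha⟩, by simp⟩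
  have hlen : l.length = A.card := List.length_ofFn
  have hl : l ≠ [] := by
    rw [← List.length_pos_iff, hlen]
    exact hA.card_pos
  have h := hK n l hl hlen.le (hlet ▸ Finset.card_image_le) (by
    intro p hp v
    obtain ⟨i, rfl⟩ := List.mem_ofFn.1 hp
    exact abs_rankFun_le hn v)
  rw [hlet] at h
  rw [blockCumulant, norm_jointCumulant_eq]
  convert h using 4
  simp only [l, List.map_ofFn]
  rfl

end CumulantBound

/-! ### Summing block weights over words by exploring a connected structure -/

section WordSums

variable {X : Type*} [Fintype X] [DecidableEq X] {n : ℕ}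

open scoped Classical in
/-- The weight `1` of a block on which the word is constant, and `1 / n` of any other block. -/
def blockWeight (e : Finset X) (j : X → Fin n) : ℝ :=
  if ∀ a ∈ e, ∀ b ∈ e, j a = j b then 1 else (n : ℝ)⁻¹

theorem blockWeight_nonneg (e : Finset X) (j : X → Fin n) : 0 ≤ blockWeight e j := by
  unfold blockWeight; split_ifs <;> positivity

theorem blockWeight_le_one (e : Finset X) (j : X → Fin n) : blockWeight e j ≤ 1 := by
  unfold blockWeight; split_ifs
  · exact le_rfl
  · exact Nat.cast_inv_le_one n

/-- The words that are constant on the members of `σ`, take values in `D t` at each `t ∈ T`, and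
agree with `w` on `V`. -/
def partialWords (σ : Finset (Finset X)) (T : Finset X) (D : X → Finset (Fin n)) (V : Finset X)
    (w : X → Fin n) : Finset (X → Fin n) :=
  {j | (∀ E ∈ σ, ∀ a ∈ E, ∀ b ∈ E, j a = j b) ∧ (∀ t ∈ T, j t ∈ D t) ∧ ∀ u ∈ V, j u = w u}

variable {σ L : Finset (Finset X)} {T : Finset X} {D : X → Finset (Fin n)}

/-- Reveals the letter at one further point `x`. The words with `j x = y` agree with
`Function.update w x y` on `insert x V`, and `c y` is the cost of this value. -/
theorem sum_partialWords_step {V : Finset X} {w : X → Fin n} {x : X} (hx : x ∉ V)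
    (c : Fin n → ℝ) (hc : ∀ y, 0 ≤ c y) {S : ℝ}
    (hS : ∀ w', ∑ j ∈ partialWords σ T D (insert x V) w',
      ∏ e ∈ L with ¬ e ⊆ insert x V, blockWeight e j ≤ S)
    (hle : ∀ j ∈ partialWords σ T D V w, ∏ e ∈ L with ¬ e ⊆ V, blockWeight e j ≤
      c (j x) * ∏ e ∈ L with ¬ e ⊆ insert x V, blockWeight e j) :
    ∑ j ∈ partialWords σ T D V w, ∏ e ∈ L with ¬ e ⊆ V, blockWeight e j ≤ (∑ y, c y) * S := by
  refine (Finset.sum_le_sum hle).trans ?_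
  rw [← Finset.sum_fiberwise _ (fun j => j x), Finset.sum_mul]
  refine Finset.sum_le_sum fun y _ => ?_
  have h1 : ∑ j ∈ partialWords σ T D V w with j x = y,
      c (j x) * ∏ e ∈ L with ¬ e ⊆ insert x V, blockWeight e j =
      c y * ∑ j ∈ partialWords σ T D V w with j x = y,
        ∏ e ∈ L with ¬ e ⊆ insert x V, blockWeight e j := by
    rw [Finset.mul_sum]
    exact Finset.sum_congr rfl fun j hj => by rw [(Finset.mem_filter.1 hj).2]
  rw [h1]
  refine mul_le_mul_of_nonneg_left (le_trans ?_ (hS (Function.update w x y))) (hc y)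
  refine Finset.sum_le_sum_of_subset_of_nonneg ?_ fun j _ _ =>
    Finset.prod_nonneg fun e _ => blockWeight_nonneg e j
  intro j hj
  simp only [partialWords, Finset.mem_filter, Finset.mem_univ, true_and] at hj ⊢
  refine ⟨hj.1.1, hj.1.2.1, fun u hu => ?_⟩
  rcases Finset.mem_insert.1 hu with rfl | hu
  · rw [Function.update_self, hj.2]
  · rw [Function.update_of_ne (ne_of_mem_of_not_mem hu hx), hj.1.2.2 u hu]

theorem prod_blockWeight_le_of_subset {L' : Finset (Finset X)} (h : L' ⊆ L) (j : X → Fin n) :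
    ∏ e ∈ L, blockWeight e j ≤ ∏ e ∈ L', blockWeight e j :=
  Finset.prod_le_prod_of_subset_of_le_one h (fun e _ => blockWeight_nonneg e j)
    (fun e _ _ => blockWeight_le_one e j)

theorem prod_blockWeight_filter_mono {V V' : Finset X} (h : V ⊆ V') (j : X → Fin n) :
    ∏ e ∈ L with ¬ e ⊆ V, blockWeight e j ≤ ∏ e ∈ L with ¬ e ⊆ V', blockWeight e j :=
  prod_blockWeight_le_of_subset
    (Finset.monotone_filter_right L fun _ _ he hV => he (hV.trans h)) j

/-- `V` is the set of points whose letters are already known. Points of `T` are revealed first, at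
the cost of `#(D t)` values each; afterwards `hconn` always provides an unknown point linked to a
known one, at the cost of a factor at most `2`. A pair keeps its weight in the product only while it
is not contained in `V`. -/
theorem sum_partialWords_le (hn : 0 < n) (hL : ∀ e ∈ L, e.card = 2)
    (hconn : ∀ V : Finset X, T ⊆ V → V ≠ univ → ∃ u ∈ V, ∃ x ∉ V,
      (∃ E ∈ σ, u ∈ E ∧ x ∈ E) ∨ ∃ e ∈ L, u ∈ e ∧ x ∈ e) (V : Finset X) (w : X → Fin n) :
    ∑ j ∈ partialWords σ T D V w, ∏ e ∈ L with ¬ e ⊆ V, blockWeight e j ≤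
      2 ^ (Vᶜ).card * ∏ t ∈ T \ V, ((D t).card : ℝ) := by
  induction hm : (Vᶜ).card generalizing V w with
  | zero =>
    have hV : V = univ := by simpa using hm
    subst hV
    have h1 : (partialWords σ T D univ w).card ≤ 1 := by
      refine Finset.card_le_one.2 fun j hj j' hj' => ?_
      simp only [partialWords, Finset.mem_filter, Finset.mem_univ, true_and] at hj hj'
      funext u
      rw [hj.2.2 u trivial, hj'.2.2 u trivial]
    have h2 : T \ univ = ∅ := Finset.sdiff_eq_empty_iff_subset.2 (Finset.subset_univ T)
    simpa [h2] using (Nat.cast_le (α := ℝ)).2 h1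
  | succ m ih =>
    have hins : ∀ x ∉ V, ((insert x V)ᶜ).card = m := fun x hx => by
      rw [Finset.compl_insert, Finset.card_erase_of_mem (by simpa using hx), hm]; rfl
    by_cases hT : T ⊆ V
    · have hT' : ∀ x, T \ insert x V = ∅ := fun x =>
        Finset.sdiff_eq_empty_iff_subset.2 (hT.trans (Finset.subset_insert _ _))
      have hVu : V ≠ univ := by rintro rfl; simp at hm
      obtain ⟨u, hu, x, hx, h⟩ := hconn V hT hVu
      have hS : ∀ w', ∑ j ∈ partialWords σ T D (insert x V) w',
          ∏ e ∈ L with ¬ e ⊆ insert x V, blockWeight e j ≤ 2 ^ m := fun w' => by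
        simpa [hT' x] using ih (insert x V) w' (hins x hx)
      rw [Finset.sdiff_eq_empty_iff_subset.2 hT, Finset.prod_empty, mul_one, pow_succ']
      have hn' : (0 : ℝ) < n := by exact_mod_cast hn
      suffices hc : ∃ c : Fin n → ℝ, (∀ y, 0 ≤ c y) ∧ ∑ y, c y ≤ 2 ∧
          ∀ j ∈ partialWords σ T D V w, ∏ e ∈ L with ¬ e ⊆ V, blockWeight e j ≤
            c (j x) * ∏ e ∈ L with ¬ e ⊆ insert x V, blockWeight e j by
        obtain ⟨c, hc0, hc2, hc⟩ := hc
        exact (sum_partialWords_step hx c hc0 hS hc).trans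
          (mul_le_mul_of_nonneg_right hc2 (by positivity))
      rcases h with ⟨E, hE, huE, hxE⟩ | ⟨e, he, hue, hxe⟩
      -- Inside a member of `σ` the letter at `x` is forced to equal the one at `u`.
      · refine ⟨fun y => if y = w u then 1 else 0, fun y => by positivity, by simp,
          fun j hj => ?_⟩
        simp only [partialWords, Finset.mem_filter, Finset.mem_univ, true_and] at hj
        simp only
        rw [hj.1 E hE x hxE u huE, hj.2.2 u hu, if_pos rfl, one_mul]
        exact prod_blockWeight_filter_mono (Finset.subset_insert _ _) j
      -- Through a pair the total cost is `1` for the equal letter plus at most `n · (1/n)` for all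
      -- the others.
      · refine ⟨fun y => if y = w u then 1 else (n : ℝ)⁻¹, fun y => by positivity, ?_,
          fun j hj => ?_⟩
        · have : ∀ y : Fin n, (if y = w u then (1 : ℝ) else (n : ℝ)⁻¹) ≤
              (if y = w u then 1 else 0) + (n : ℝ)⁻¹ := fun y => by
            split_ifs
            · have : (0 : ℝ) ≤ (n : ℝ)⁻¹ := by positivity
              linarith
            · linarith
          refine (Finset.sum_le_sum fun y _ => this y).trans ?_
          rw [Finset.sum_add_distrib]
          simp [hn'.ne']
          norm_num
        · simp only [partialWords, Finset.mem_filter, Finset.mem_univ, true_and] at hj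
          have heq : e = {u, x} := by
            refine (Finset.eq_of_subset_of_card_le ?_ ?_).symm
            · intro z hz
              rcases Finset.mem_insert.1 hz with rfl | hz
              · exact hue
              · rwa [Finset.mem_singleton.1 hz]
            · rw [hL e he, Finset.card_pair (ne_of_mem_of_not_mem hu hx)]
          have hmem : e ∈ L.filter (fun e => ¬ e ⊆ V) :=
            Finset.mem_filter.2 ⟨he, fun h => hx (h hxe)⟩
          rw [← Finset.mul_prod_erase _ _ hmem]
          refine mul_le_mul ?_ ?_ (Finset.prod_nonneg fun e _ => blockWeight_nonneg e j)
            (by positivity)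
          · simp only [blockWeight]
            by_cases hjx : j x = w u
            · rw [if_pos hjx]
              split_ifs
              · exact le_rfl
              · exact Nat.cast_inv_le_one n
            · rw [if_neg hjx, if_neg]
              exact fun h => hjx ((h x hxe u hue).trans (hj.2.2 u hu))
          -- The weight of `e` is spent here: `e = {u, x}` lies in `insert x V` and no longer occurs
          -- in the remaining product.
          · refine prod_blockWeight_le_of_subset (fun e' he' => ?_) j
            rw [Finset.mem_filter] at he'
            refine Finset.mem_erase.2 ⟨?_, Finset.mem_filter.2
              ⟨he'.1, fun h => he'.2 (h.trans (Finset.subset_insert _ _))⟩⟩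
            rintro rfl
            refine he'.2 ?_
            rw [heq]
            intro z hz
            rcases Finset.mem_insert.1 hz with rfl | hz
            · exact Finset.mem_insert_of_mem hu
            · rw [Finset.mem_singleton.1 hz]
              exact Finset.mem_insert_self _ _
    · obtain ⟨t, htT, htV⟩ := Finset.not_subset.1 hT
      have hS := fun w' => ih (insert t V) w' (hins t htV)
      have hstep := sum_partialWords_step (w := w) htV (fun y => if y ∈ D t then (1 : ℝ) else 0)
        (fun y => by split_ifs <;> norm_num) hS (fun j hj => by
          simp only [partialWords, Finset.mem_filter, Finset.mem_univ, true_and] at hj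
          rw [if_pos (hj.2.1 t htT), one_mul]
          exact prod_blockWeight_filter_mono (Finset.subset_insert _ _) j)
      refine hstep.trans ?_
      have hsd : T \ V = insert t (T \ insert t V) := by
        rw [Finset.sdiff_insert, Finset.insert_erase (Finset.mem_sdiff.2 ⟨htT, htV⟩)]
      rw [hsd, Finset.prod_insert (by rw [Finset.mem_sdiff]; simp)]
      have hsum : ∑ y, (if y ∈ D t then (1 : ℝ) else 0) = (D t).card := by
        rw [Finset.sum_boole, Finset.filter_mem_eq_inter, Finset.univ_inter]
      have hp : (0 : ℝ) ≤ ((D t).card : ℝ) * ∏ s ∈ T \ insert t V, ((D s).card : ℝ) :=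
        mul_nonneg (Nat.cast_nonneg _) (Finset.prod_nonneg fun s _ => Nat.cast_nonneg _)
      have hpow : (2 : ℝ) ^ m ≤ 2 ^ (m + 1) := pow_le_pow_right₀ (by norm_num) (Nat.le_succ m)
      rw [hsum, mul_left_comm]
      exact mul_le_mul_of_nonneg_right hpow hp

/-- The total weight of the words that are constant on the members of `σ` and take values in `D t`
at each `t ∈ T`, provided every point is linked to `T`. -/
theorem sum_words_prod_blockWeight_le (hn : 0 < n) (hL : ∀ e ∈ L, e.card = 2)
    (hconn : ∀ V : Finset X, T ⊆ V → V ≠ univ → ∃ u ∈ V, ∃ x ∉ V,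
      (∃ E ∈ σ, u ∈ E ∧ x ∈ E) ∨ ∃ e ∈ L, u ∈ e ∧ x ∈ e) (D : X → Finset (Fin n)) :
    ∑ j : X → Fin n with (∀ E ∈ σ, ∀ a ∈ E, ∀ b ∈ E, j a = j b) ∧ ∀ t ∈ T, j t ∈ D t,
      ∏ e ∈ L, blockWeight e j ≤ 2 ^ Fintype.card X * ∏ t ∈ T, ((D t).card : ℝ) := by
  have h := sum_partialWords_le (D := D) hn hL hconn ∅ (fun _ => ⟨0, hn⟩)
  have hf : L.filter (fun e => ¬ e ⊆ ∅) = L := by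
    refine Finset.filter_true_of_mem fun e he hsub => ?_
    have := hL e he
    rw [Finset.subset_empty.1 hsub] at this
    simp at this
  rw [hf] at h
  simpa [partialWords] using h

end WordSums

/-! ### The sum over words with one large block and otherwise pairs -/

section PartitionSums

variable {M : ℕ}

theorem card_eq_sum_card_inter_parts (π : Part M) (S : Finset (Fin M)) :
    S.card = ∑ E ∈ π.parts, (S ∩ E).card := by
  rw [← Finset.card_biUnion]
  · congr 1
    ext x
    simp only [Finset.mem_biUnion, Finset.mem_inter]
    exact ⟨fun h => ⟨π.part x, π.part_mem.2 (mem_univ x), h, π.mem_part (mem_univ x)⟩,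
      fun ⟨_, _, h, _⟩ => h⟩
  · intro E hE F hF hEF
    exact (π.disjoint hE hF hEF).mono Finset.inter_subset_right Finset.inter_subset_right

theorem even_card_of_saturated {π : Part M} (hπ : ∀ E ∈ π.parts, Even E.card)
    {S : Finset (Fin M)} (hS : ∀ E ∈ π.parts, ∀ a ∈ E, ∀ b ∈ E, a ∈ S → b ∈ S) :
    Even S.card := by
  rw [card_eq_sum_card_inter_parts π S]
  refine Finset.even_sum _ fun E hE => ?_
  by_cases h : ∃ a ∈ E, a ∈ S
  · obtain ⟨a, haE, haS⟩ := h
    rw [Finset.inter_eq_right.2 fun b hb => hS E hE a haE b hb haS]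
    exact hπ E hE
  · push Not at h
    have : S ∩ E = ∅ := Finset.eq_empty_of_forall_notMem fun b hb =>
      h b (Finset.mem_inter.1 hb).2 (Finset.mem_inter.1 hb).1
    simp [this]

/-- Every block of `π` other than `A` meets `S` in nothing or in all of its points, hence in an even
number; the intersection with `A` inherits the parity of `S`. -/
theorem even_card_inter_of_saturated {π : Part M} (hπ : ∀ E ∈ π.parts, Even E.card)
    {A : Finset (Fin M)} (hA : A ∈ π.parts) {S : Finset (Fin M)} (hcard : Even S.card)
    (hS : ∀ E ∈ π.parts, E ≠ A → ∀ a ∈ E, ∀ b ∈ E, a ∈ S → b ∈ S) :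
    Even (S ∩ A).card := by
  have h := card_eq_sum_card_inter_parts π S
  rw [← Finset.add_sum_erase _ _ hA] at h
  have h2 : Even (∑ E ∈ π.parts.erase A, (S ∩ E).card) := by
    refine Finset.even_sum _ fun E hE => ?_
    obtain ⟨hEA, hE⟩ := Finset.mem_erase.1 hE
    by_cases h : ∃ a ∈ E, a ∈ S
    · obtain ⟨a, haE, haS⟩ := h
      rw [Finset.inter_eq_right.2 fun b hb => hS E hE hEA a haE b hb haS]
      exact hπ E hE
    · push Not at h
      have : S ∩ E = ∅ := Finset.eq_empty_of_forall_notMem fun b hb =>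
        h b (Finset.mem_inter.1 hb).2 (Finset.mem_inter.1 hb).1
      simp [this]
  rw [h] at hcard
  exact (Nat.even_add.1 hcard).2 h2

/-- A block `A` of `π` contains at most `#A / 2` points such that every set that is saturated for
`σ` and for the other blocks of `π`, and contains these points, contains `A`. -/
theorem exists_representatives {π σ : Part M} (hπ : ∀ E ∈ π.parts, Even E.card)
    (hσ : ∀ E ∈ σ.parts, Even E.card) {A : Finset (Fin M)} (hA : A ∈ π.parts) :
    ∃ T ⊆ A, 2 * T.card ≤ A.card ∧ ∀ V : Finset (Fin M), T ⊆ V →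
      (∀ E ∈ σ.parts, ∀ a ∈ E, ∀ b ∈ E, a ∈ V → b ∈ V) →
      (∀ E ∈ π.parts, E ≠ A → ∀ a ∈ E, ∀ b ∈ E, a ∈ V → b ∈ V) → A ⊆ V := by
  classical
  -- The components that remain connected when the block `A` is removed. One point of `A` is chosen
  -- from each component that meets `A`.
  let r : Setoid (Fin M) := Relation.EqvGen.setoid fun a b =>
    (∃ E ∈ σ.parts, a ∈ E ∧ b ∈ E) ∨ ∃ E ∈ π.parts, E ≠ A ∧ a ∈ E ∧ b ∈ E
  let q : Fin M → Quotient r := Quotient.mk r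
  have hq1 : ∀ E ∈ σ.parts, ∀ a ∈ E, ∀ b ∈ E, q a = q b := fun E hE a ha b hb =>
    Quotient.sound (Relation.EqvGen.rel _ _ (Or.inl ⟨E, hE, ha, hb⟩))
  have hq2 : ∀ E ∈ π.parts, E ≠ A → ∀ a ∈ E, ∀ b ∈ E, q a = q b := fun E hE hEA a ha b hb =>
    Quotient.sound (Relation.EqvGen.rel _ _ (Or.inr ⟨E, hE, hEA, ha, hb⟩))
  have hrep : ∀ c ∈ A.image q, ∃ a, a ∈ A ∧ q a = c := fun c hc => by simpa using hc
  have : Nonempty (Fin M) := (π.nonempty_of_mem_parts hA).to_type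
  choose! rep hrepA hrepq using hrep
  refine ⟨(A.image q).image rep, ?_, ?_, ?_⟩
  · intro t ht
    obtain ⟨c, hc, rfl⟩ := Finset.mem_image.1 ht
    exact hrepA c hc
  · have h1 : 2 * (A.image q).card ≤ A.card := by
      rw [mul_comm]
      rw [Finset.card_eq_sum_card_image q A, ← smul_eq_mul]
      refine Finset.card_nsmul_le_sum _ _ _ fun c hc => ?_
      obtain ⟨a, ha, rfl⟩ := Finset.mem_image.1 hc
      -- A component is a union of blocks of `σ`, so it has even size and meets `A` in an even
      -- number of points. Being nonempty, this intersection has at least two points, so at most `#A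
      -- / 2` components meet `A`.
      have hS : Even ({x | q x = q a} : Finset (Fin M)).card :=
        even_card_of_saturated hσ fun E hE x hx y hy h => by
          simp only [Finset.mem_filter, Finset.mem_univ, true_and] at h ⊢
          rw [← hq1 E hE x hx y hy, h]
      have hSA := even_card_inter_of_saturated hπ hA hS fun E hE hEA x hx y hy h => by
          simp only [Finset.mem_filter, Finset.mem_univ, true_and] at h ⊢
          rw [← hq2 E hE hEA x hx y hy, h]
      have he : ({x | q x = q a} : Finset (Fin M)) ∩ A = {x ∈ A | q x = q a} := by
        ext x; simp [and_comm]
      rw [he] at hSA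
      have hpos : 0 < ({x ∈ A | q x = q a} : Finset (Fin M)).card :=
        Finset.card_pos.2 ⟨a, by simp [ha]⟩
      obtain ⟨m, hm⟩ := hSA
      omega
    have h2 : ((A.image q).image rep).card ≤ (A.image q).card := Finset.card_image_le
    omega
  · intro V hTV hVσ hVπ a ha
    have hsat : ∀ x y, Relation.EqvGen (fun a b =>
        (∃ E ∈ σ.parts, a ∈ E ∧ b ∈ E) ∨ ∃ E ∈ π.parts, E ≠ A ∧ a ∈ E ∧ b ∈ E) x y →
        (x ∈ V ↔ y ∈ V) := by
      intro x y h
      induction h with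
      | rel x y h =>
        rcases h with ⟨E, hE, hx, hy⟩ | ⟨E, hE, hEA, hx, hy⟩
        · exact ⟨hVσ E hE x hx y hy, hVσ E hE y hy x hx⟩
        · exact ⟨hVπ E hE hEA x hx y hy, hVπ E hE hEA y hy x hx⟩
      | refl x => rfl
      | symm x y _ ih => exact ih.symm
      | trans x y z _ _ ih₁ ih₂ => exact ih₁.trans ih₂
    have hc : q a ∈ A.image q := Finset.mem_image_of_mem q ha
    exact (hsat _ _ (Quotient.exact (hrepq _ hc))).1 (hTV (Finset.mem_image_of_mem rep hc))

theorem norm_blockCumulant_le_blockWeight {n : ℕ} (hn : 2 ≤ n) {K : ℝ}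
    {E : Finset (Fin M)} (hE : E.Nonempty) {j : Fin M → Fin n}
    (h : ‖blockCumulant n E (E.restrict j)‖ * (n : ℝ) ^ (E.image j).card ≤ K * n) :
    ‖blockCumulant n E (E.restrict j)‖ ≤ K * blockWeight E j := by
  have hn1 : (1 : ℝ) ≤ n := by exact_mod_cast (by omega : 1 ≤ n)
  have hn0 : (0 : ℝ) < n := by linarith
  have hcard : 0 < (E.image j).card := (hE.image j).card_pos
  unfold blockWeight
  split_ifs with hc
  · have h1 : ‖blockCumulant n E (E.restrict j)‖ * (n : ℝ) ^ 1 ≤ K * n :=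
      (mul_le_mul_of_nonneg_left (pow_le_pow_right₀ hn1 hcard) (norm_nonneg _)).trans h
    rw [pow_one] at h1
    rw [mul_one]
    exact le_of_mul_le_mul_right h1 hn0
  · have hcard2 : 2 ≤ (E.image j).card := by
      push Not at hc
      obtain ⟨a, ha, b, hb, hab⟩ := hc
      exact Finset.one_lt_card.2 ⟨j a, Finset.mem_image_of_mem j ha, j b,
        Finset.mem_image_of_mem j hb, hab⟩
    have h1 : ‖blockCumulant n E (E.restrict j)‖ * (n : ℝ) ^ 2 ≤ K * n :=
      (mul_le_mul_of_nonneg_left (pow_le_pow_right₀ hn1 hcard2) (norm_nonneg _)).trans h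
    rw [← div_eq_mul_inv, le_div_iff₀ hn0]
    rw [pow_two, ← mul_assoc] at h1
    exact le_of_mul_le_mul_right h1 hn0

/-- The indicator of the event that the word takes values in `S` on `E`. -/
def valuesIn {n : ℕ} (E : Finset (Fin M)) (S : Finset (Fin n)) (j : Fin M → Fin n) : ℝ :=
  if E.image j ⊆ S then 1 else 0

theorem valuesIn_nonneg {n : ℕ} (E : Finset (Fin M)) (S : Finset (Fin n)) (j : Fin M → Fin n) :
    0 ≤ valuesIn E S j := by
  unfold valuesIn; split_ifs <;> norm_num

theorem valuesIn_of_image_eq {n : ℕ} {E : Finset (Fin M)} {S : Finset (Fin n)}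
    {j : Fin M → Fin n} (h : E.image j = S) : valuesIn E S j = 1 := if_pos h.subset

/-- The cases of at least three, exactly two and exactly one value on `E` give the three terms. Sums
of indicators replace the case distinction so that the sum over words can be taken for each fixed
value set; overcounting is harmless in an upper bound. -/
theorem norm_blockCumulant_le_sum_indicator {n : ℕ} (hn : 2 ≤ n) {K : ℝ} (hK0 : 0 ≤ K)
    {E : Finset (Fin M)} (hE : E.Nonempty) {j : Fin M → Fin n}
    (h : ‖blockCumulant n E (E.restrict j)‖ * (n : ℝ) ^ (E.image j).card ≤ K * n) :
    ‖blockCumulant n E (E.restrict j)‖ ≤ K * (((n : ℝ) ^ 2)⁻¹ +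
      (n : ℝ)⁻¹ * ∑ x, ∑ y, valuesIn E {x, y} j + ∑ x, valuesIn E {x} j) := by
  have hn1 : (1 : ℝ) ≤ n := by exact_mod_cast (by omega : 1 ≤ n)
  have hn0 : (0 : ℝ) < n := by linarith
  have hcard : 0 < (E.image j).card := (hE.image j).card_pos
  have hb : ∀ m, m ≤ (E.image j).card →
      ‖blockCumulant n E (E.restrict j)‖ * (n : ℝ) ^ m ≤ K * n := fun m hm =>
    (mul_le_mul_of_nonneg_left (pow_le_pow_right₀ hn1 hm) (norm_nonneg _)).trans h
  have h2 : 0 ≤ ∑ x, ∑ y, valuesIn E {x, y} j :=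
    Finset.sum_nonneg fun x _ => Finset.sum_nonneg fun y _ => valuesIn_nonneg _ _ _
  have h1 : 0 ≤ ∑ x, valuesIn E {x} j := Finset.sum_nonneg fun x _ => valuesIn_nonneg _ _ _
  have hs2 : ∀ x y, E.image j = {x, y} → 1 ≤ ∑ x, ∑ y, valuesIn E {x, y} j := by
    intro x y hxy
    rw [← valuesIn_of_image_eq hxy]
    refine (Finset.single_le_sum (f := fun y => valuesIn E {x, y} j)
      (fun y _ => valuesIn_nonneg _ _ _) (mem_univ y)).trans ?_
    exact Finset.single_le_sum (f := fun x => ∑ y, valuesIn E {x, y} j)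
      (fun x _ => Finset.sum_nonneg fun y _ => valuesIn_nonneg _ _ _) (mem_univ x)
  have hs1 : ∀ x, E.image j = {x} → 1 ≤ ∑ x, valuesIn E {x} j := by
    intro x hx
    rw [← valuesIn_of_image_eq hx]
    exact Finset.single_le_sum (f := fun x => valuesIn E {x} j)
      (fun y _ => valuesIn_nonneg _ _ _) (mem_univ x)
  have hn2 : 0 ≤ ((n : ℝ) ^ 2)⁻¹ := by positivity
  have hni : 0 ≤ (n : ℝ)⁻¹ := by positivity
  generalize ∑ x, ∑ y, valuesIn E {x, y} j = s₂ at *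
  generalize ∑ x, valuesIn E {x} j = s₁ at *
  have hns := mul_nonneg hni h2
  rcases Nat.lt_or_ge 2 (E.image j).card with h3 | h3
  · have hb3 := hb 3 h3
    have : ‖blockCumulant n E (E.restrict j)‖ ≤ K * ((n : ℝ) ^ 2)⁻¹ := by
      rw [← div_eq_mul_inv, le_div_iff₀ (by positivity)]
      rw [pow_succ, ← mul_assoc] at hb3
      exact le_of_mul_le_mul_right hb3 hn0
    exact this.trans (mul_le_mul_of_nonneg_left (by linarith) hK0)
  rcases Nat.lt_or_ge 1 (E.image j).card with h4 | h4
  · have hb2 := hb 2 h4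
    obtain ⟨x, y, _, hxy⟩ := Finset.card_eq_two.1 (le_antisymm h3 h4)
    have : ‖blockCumulant n E (E.restrict j)‖ ≤ K * (n : ℝ)⁻¹ := by
      rw [← div_eq_mul_inv, le_div_iff₀ (by positivity)]
      rw [pow_succ, pow_one, ← mul_assoc] at hb2
      exact le_of_mul_le_mul_right hb2 hn0
    refine this.trans (mul_le_mul_of_nonneg_left ?_ hK0)
    have h5 : (n : ℝ)⁻¹ * 1 ≤ (n : ℝ)⁻¹ * s₂ := mul_le_mul_of_nonneg_left (hs2 x y hxy) hni
    linarith
  · have hb1 := hb 1 hcard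
    obtain ⟨x, hx⟩ := Finset.card_eq_one.1 (le_antisymm h4 hcard)
    have hs := hs1 x hx
    rw [pow_one] at hb1
    have : ‖blockCumulant n E (E.restrict j)‖ ≤ K := le_of_mul_le_mul_right hb1 hn0
    exact this.trans (le_mul_of_one_le_right hK0 (by linarith))

/-- The sum of the weights of the words that take values in `S` on the block `A`, and are constant
off the set `B`. -/
theorem sum_valuesIn_mul_prod_le {n : ℕ} (hn : 0 < n) {σ : Part M} {L : Finset (Finset (Fin M))}
    (hL : ∀ e ∈ L, e.card = 2) {A B T T₀ : Finset (Fin M)} (hTA : T ⊆ A)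
    (hconn : ∀ V : Finset (Fin M), T ∪ T₀ ∪ Bᶜ ⊆ V → V ≠ univ → ∃ u ∈ V, ∃ x ∉ V,
      (∃ E ∈ σ.parts, u ∈ E ∧ x ∈ E) ∨ ∃ e ∈ L, u ∈ e ∧ x ∈ e) (S : Finset (Fin n))
    {m : ℕ} (hT : T.card ≤ m) (hS : S.Nonempty) :
    ∑ j ∈ words σ n with ∀ x ∉ B, j x = ⟨0, hn⟩, valuesIn A S j * ∏ e ∈ L, blockWeight e j ≤
      2 ^ M * ((S.card : ℝ) ^ m * (n : ℝ) ^ T₀.card) := by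
  classical
  -- Points of `T` have `#S` choices, the remaining points of `T₀` in `B` have `n`, and those off
  -- `B` are pinned, so they contribute a factor `1`.
  let D : Fin M → Finset (Fin n) := fun t =>
    if t ∈ T then S else if t ∈ B then univ else {⟨0, hn⟩}
  have h := sum_words_prod_blockWeight_le hn hL hconn D
  rw [Fintype.card_fin] at h
  have hn1 : (1 : ℝ) ≤ n := by exact_mod_cast hn
  have hS1 : (1 : ℝ) ≤ S.card := by exact_mod_cast hS.card_pos
  have hD : ∏ t ∈ T ∪ T₀ ∪ Bᶜ, ((D t).card : ℝ) ≤ (S.card : ℝ) ^ m * (n : ℝ) ^ T₀.card := by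
    calc ∏ t ∈ T ∪ T₀ ∪ Bᶜ, ((D t).card : ℝ)
        ≤ ∏ t ∈ T ∪ T₀ ∪ Bᶜ,
          ((if t ∈ T then (S.card : ℝ) else 1) * (if t ∈ T₀ then (n : ℝ) else 1)) := by
          refine Finset.prod_le_prod (fun _ _ => Nat.cast_nonneg _) fun t ht => ?_
          simp only [Finset.mem_union, Finset.mem_compl] at ht
          by_cases h1 : t ∈ T
          · simp only [D, if_pos h1]
            refine le_mul_of_one_le_right (by positivity) ?_
            split_ifs
            exacts [hn1, le_rfl]
          · by_cases h2 : t ∈ B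
            · have h3 : t ∈ T₀ := by tauto
              simp [D, h1, h2, h3]
            · simp only [D, if_neg h1, if_neg h2, Finset.card_singleton, Nat.cast_one, one_mul]
              split_ifs
              exacts [hn1, le_rfl]
      _ = (S.card : ℝ) ^ T.card * (n : ℝ) ^ T₀.card := by
          rw [Finset.prod_mul_distrib, Finset.prod_ite_mem, Finset.prod_ite_mem,
            Finset.inter_eq_right.2 (Finset.subset_union_left.trans Finset.subset_union_left),
            Finset.inter_eq_right.2 (Finset.subset_union_right.trans Finset.subset_union_left),
            Finset.prod_const, Finset.prod_const]
      _ ≤ _ := mul_le_mul_of_nonneg_right (pow_le_pow_right₀ hS1 hT) (by positivity)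
  refine le_trans ?_ (h.trans (mul_le_mul_of_nonneg_left hD (by positivity)))
  have e : ∀ j : Fin M → Fin n, valuesIn A S j * ∏ e ∈ L, blockWeight e j =
      if A.image j ⊆ S then ∏ e ∈ L, blockWeight e j else 0 := fun j => by
    unfold valuesIn; split_ifs <;> simp
  simp only [e]
  rw [← Finset.sum_filter]
  refine Finset.sum_le_sum_of_subset_of_nonneg ?_ fun j _ _ =>
    Finset.prod_nonneg fun e _ => blockWeight_nonneg e j
  intro j hj
  simp only [words, Finset.mem_filter, Finset.mem_univ, true_and] at hj ⊢
  refine ⟨hj.1.1, fun t _ => ?_⟩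
  by_cases h1 : t ∈ T
  · simp only [D, if_pos h1]
    exact hj.2 (Finset.mem_image_of_mem j (hTA h1))
  · by_cases h2 : t ∈ B
    · simp [D, h1, h2]
    · simp [D, h1, h2, hj.1.2 t h2]

theorem restrictTo_erase_card_two {π : Part M} {A B : Finset (Fin M)}
    (hP : ∀ E ∈ restrictTo π B, E ≠ A → E.card = 2) :
    ∀ e ∈ (restrictTo π B).erase A, e.card = 2 := fun e he =>
  hP e (Finset.mem_erase.1 he).2 (Finset.mem_erase.1 he).1

/-- The main estimate: the sum over words that are constant off a union `B` of blocks of the join,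
when `A` is the only block of `π` in `B` which is not a pair. -/
theorem exists_sum_prod_norm_blockCumulant_le {π σ : Part M} (hπ : ∀ E ∈ π.parts, Even E.card)
    (hσ : ∀ E ∈ σ.parts, Even E.card) {A B T₀ : Finset (Fin M)} (hA : A ∈ restrictTo π B)
    (hBπ : ∀ E ∈ π.parts, ∀ a ∈ E, ∀ b ∈ E, a ∈ B → b ∈ B)
    (hP : ∀ E ∈ restrictTo π B, E ≠ A → E.card = 2) {m : ℕ} (hm : 3 ≤ m) (hAm : A.card = 2 * m)
    (hconn : ∀ V : Finset (Fin M), A ⊆ V → T₀ ⊆ V → Bᶜ ⊆ V →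
      (∀ E ∈ σ.parts, ∀ a ∈ E, ∀ b ∈ E, a ∈ V → b ∈ V) →
      (∀ E ∈ π.parts, ∀ a ∈ E, ∀ b ∈ E, a ∈ V → b ∈ V) → V = univ) :
    ∃ C : ℝ, ∀ n : ℕ, ∀ hn : 2 ≤ n,
      ∑ j ∈ words σ n with ∀ x ∉ B, j x = ⟨0, by omega⟩,
        ∏ E ∈ restrictTo π B, ‖blockCumulant n E (E.restrict j)‖ ≤
      C * (n : ℝ) ^ (T₀.card + (m - 2)) := by
  classical
  have hAπ : A ∈ π.parts := (Finset.mem_filter.1 hA).1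
  have hAB : A ⊆ B := subset_of_mem_restrictTo hA
  obtain ⟨T, hTA, hTcard, hTsat⟩ := exists_representatives hπ hσ hAπ
  have hTm : T.card ≤ m := by omega
  have hbd : ∀ E ∈ restrictTo π B, ∃ K : ℝ, 0 ≤ K ∧ ∀ n : ℕ, 2 ≤ n → ∀ j : Fin M → Fin n,
      ‖blockCumulant n E (E.restrict j)‖ * (n : ℝ) ^ (E.image j).card ≤ K * n := fun E hE =>
    exists_blockCumulant_bound E (π.nonempty_of_mem_parts (Finset.mem_filter.1 hE).1)
  choose! K hK0 hK using hbd
  set L := (restrictTo π B).erase A with hLdef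
  have hL : ∀ e ∈ L, e.card = 2 := restrictTo_erase_card_two hP
  have hLr : ∀ e ∈ L, e ∈ restrictTo π B := fun e he => (Finset.mem_erase.1 he).2
  have hlink : ∀ V : Finset (Fin M), T ∪ T₀ ∪ Bᶜ ⊆ V → V ≠ univ → ∃ u ∈ V, ∃ x ∉ V,
      (∃ E ∈ σ.parts, u ∈ E ∧ x ∈ E) ∨ ∃ e ∈ L, u ∈ e ∧ x ∈ e := by
    intro V hV hne
    by_contra hcon
    apply hne
    have hTV : T ⊆ V := (Finset.subset_union_left.trans Finset.subset_union_left).trans hV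
    have hT0V : T₀ ⊆ V := (Finset.subset_union_right.trans Finset.subset_union_left).trans hV
    have hBV : Bᶜ ⊆ V := Finset.subset_union_right.trans hV
    have hsσ : ∀ E ∈ σ.parts, ∀ a ∈ E, ∀ b ∈ E, a ∈ V → b ∈ V := fun E hE a ha b hb haV => by
      by_contra hbV
      exact hcon ⟨a, haV, b, hbV, Or.inl ⟨E, hE, ha, hb⟩⟩
    have hsπ : ∀ E ∈ π.parts, E ≠ A → ∀ a ∈ E, ∀ b ∈ E, a ∈ V → b ∈ V := by
      intro E hE hEA a ha b hb haV
      by_contra hbV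
      have hbB : b ∈ B := by
        by_contra hbB
        exact hbV (hBV (Finset.mem_compl.2 hbB))
      -- Since `Bᶜ ⊆ V`, a block of `π` that leaves `V` has a point in `B`, hence lies in `B` and is
      -- one of the pairs in `L`.
      have hEB : E ⊆ B := fun c hc => hBπ E hE b hb c hc hbB
      exact hcon ⟨a, haV, b, hbV, Or.inr ⟨E, Finset.mem_erase.2
        ⟨hEA, Finset.mem_filter.2 ⟨hE, hEB⟩⟩, ha, hb⟩⟩
    have hAV := hTsat V hTV hsσ hsπ
    refine hconn V hAV hT0V hBV hsσ fun E hE a ha b hb haV => ?_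
    by_cases hEA : E = A
    · exact hAV (hEA ▸ hb)
    · exact hsπ E hE hEA a ha b hb haV
  -- The value sets `univ`, `{x, y}` and `{x}` contribute `1`, `2 ^ m` and `1` to the last factor.
  refine ⟨K A * (∏ e ∈ L, K e) * (2 ^ M * (2 + 2 ^ m)), fun n hn => ?_⟩
  have hn0 : 0 < n := by omega
  have hn1 : (1 : ℝ) ≤ n := by exact_mod_cast hn0
  have hnpos : (0 : ℝ) < n := by exact_mod_cast hn0
  set W := (words σ n).filter (fun j => ∀ x ∉ B, j x = ⟨0, hn0⟩) with hW
  have hKp : 0 ≤ ∏ e ∈ L, K e := Finset.prod_nonneg fun e he => hK0 e (hLr e he)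
  have hKA : 0 ≤ K A := hK0 A hA
  have hsum : ∀ S : Finset (Fin n), S.Nonempty →
      ∑ j ∈ W, valuesIn A S j * ∏ e ∈ L, blockWeight e j ≤
        2 ^ M * ((S.card : ℝ) ^ m * (n : ℝ) ^ T₀.card) := fun S hS =>
    sum_valuesIn_mul_prod_le hn0 hL hTA hlink S hTm hS
  have hpoint : ∀ j ∈ W, ∏ E ∈ restrictTo π B, ‖blockCumulant n E (E.restrict j)‖ ≤
      K A * (∏ e ∈ L, K e) * (((n : ℝ) ^ 2)⁻¹ * (valuesIn A univ j * ∏ e ∈ L, blockWeight e j) +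
        (n : ℝ)⁻¹ * ∑ x, ∑ y, valuesIn A {x, y} j * ∏ e ∈ L, blockWeight e j +
        ∑ x, valuesIn A {x} j * ∏ e ∈ L, blockWeight e j) := by
    intro j _
    have h1 := norm_blockCumulant_le_sum_indicator hn hKA (π.nonempty_of_mem_parts hAπ)
      (hK A hA n hn j)
    have h2 : ∏ E ∈ L, ‖blockCumulant n E (E.restrict j)‖ ≤
        ∏ E ∈ L, K E * blockWeight E j :=
      Finset.prod_le_prod (fun _ _ => norm_nonneg _) fun E hE =>
        norm_blockCumulant_le_blockWeight hn
          (π.nonempty_of_mem_parts (Finset.mem_filter.1 (hLr E hE)).1) (hK E (hLr E hE) n hn j)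
    rw [Finset.prod_mul_distrib] at h2
    rw [← Finset.mul_prod_erase _ _ hA]
    refine (mul_le_mul h1 h2 (Finset.prod_nonneg fun _ _ => norm_nonneg _)
      ((norm_nonneg _).trans h1)).trans (le_of_eq ?_)
    have h3 : valuesIn A univ j = 1 := if_pos (Finset.subset_univ _)
    simp only [h3, ← Finset.sum_mul]
    ring
  refine (Finset.sum_le_sum hpoint).trans ?_
  have hcomm₂ : ∑ j ∈ W, ∑ x, ∑ y, valuesIn A {x, y} j * ∏ e ∈ L, blockWeight e j =
      ∑ x, ∑ y, ∑ j ∈ W, valuesIn A {x, y} j * ∏ e ∈ L, blockWeight e j := by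
    rw [Finset.sum_comm]
    exact Finset.sum_congr rfl fun x _ => Finset.sum_comm
  have hcomm₁ : ∑ j ∈ W, ∑ x, valuesIn A {x} j * ∏ e ∈ L, blockWeight e j =
      ∑ x, ∑ j ∈ W, valuesIn A {x} j * ∏ e ∈ L, blockWeight e j := Finset.sum_comm
  rw [← Finset.mul_sum, Finset.sum_add_distrib, Finset.sum_add_distrib, ← Finset.mul_sum,
    ← Finset.mul_sum, hcomm₁, hcomm₂]
  have : Nonempty (Fin n) := ⟨⟨0, hn0⟩⟩
  have hU := hsum univ Finset.univ_nonempty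
  rw [Finset.card_univ, Fintype.card_fin] at hU
  have h2 : ∑ x, ∑ y, ∑ j ∈ W, valuesIn A {x, y} j * ∏ e ∈ L, blockWeight e j ≤
      ∑ _x : Fin n, ∑ _y : Fin n, 2 ^ M * ((2 : ℝ) ^ m * (n : ℝ) ^ T₀.card) := by
    refine Finset.sum_le_sum fun x _ => Finset.sum_le_sum fun y _ =>
      (hsum {x, y} (Finset.insert_nonempty _ _)).trans ?_
    have hc : ((({x, y} : Finset (Fin n)).card : ℕ) : ℝ) ≤ 2 := by
      exact_mod_cast Finset.card_le_two
    gcongr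
  have h1 : ∑ x, ∑ j ∈ W, valuesIn A {x} j * ∏ e ∈ L, blockWeight e j ≤
      ∑ _x : Fin n, 2 ^ M * (n : ℝ) ^ T₀.card := by
    refine Finset.sum_le_sum fun x _ => (hsum {x} (Finset.singleton_nonempty _)).trans ?_
    simp
  simp only [Finset.sum_const, Finset.card_univ, Fintype.card_fin, nsmul_eq_mul] at h1 h2
  obtain ⟨p, rfl⟩ : ∃ p, m = p + 2 := ⟨m - 2, by omega⟩
  -- Here `m ≥ 3` enters: the cases of one or two values on `A` are of order `n`, which must not
  -- exceed `n^{m-2}`.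
  have hnp : (n : ℝ) ≤ (n : ℝ) ^ p := le_self_pow₀ hn1 (by omega)
  have hU' := mul_le_mul_of_nonneg_left hU (by positivity : (0 : ℝ) ≤ ((n : ℝ) ^ 2)⁻¹)
  have h2' := mul_le_mul_of_nonneg_left h2 (by positivity : (0 : ℝ) ≤ (n : ℝ)⁻¹)
  have eU : ((n : ℝ) ^ 2)⁻¹ * (2 ^ M * ((n : ℝ) ^ (p + 2) * (n : ℝ) ^ T₀.card)) =
      2 ^ M * (n : ℝ) ^ T₀.card * (n : ℝ) ^ p := by
    field_simp
    ring
  have e2 : (n : ℝ)⁻¹ * ((n : ℝ) * ((n : ℝ) * (2 ^ M * ((2 : ℝ) ^ (p + 2) * (n : ℝ) ^ T₀.card)))) =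
      2 ^ M * (n : ℝ) ^ T₀.card * 2 ^ (p + 2) * n := by
    field_simp
  rw [eU] at hU'
  rw [e2] at h2'
  have h3 : 2 ^ M * (n : ℝ) ^ T₀.card * 2 ^ (p + 2) * n ≤
      2 ^ M * (n : ℝ) ^ T₀.card * 2 ^ (p + 2) * (n : ℝ) ^ p :=
    mul_le_mul_of_nonneg_left hnp (by positivity)
  have h4 : 2 ^ M * (n : ℝ) ^ T₀.card * n ≤ 2 ^ M * (n : ℝ) ^ T₀.card * (n : ℝ) ^ p :=
    mul_le_mul_of_nonneg_left hnp (by positivity)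
  rw [mul_assoc (K A * ∏ e ∈ L, K e)]
  refine mul_le_mul_of_nonneg_left ?_ (mul_nonneg hKA hKp)
  have e3 : 2 ^ M * (2 + (2 : ℝ) ^ (p + 2)) * (n : ℝ) ^ (T₀.card + (p + 2 - 2)) =
      2 ^ M * (n : ℝ) ^ T₀.card * (n : ℝ) ^ p +
      2 ^ M * (n : ℝ) ^ T₀.card * 2 ^ (p + 2) * (n : ℝ) ^ p +
      2 ^ M * (n : ℝ) ^ T₀.card * (n : ℝ) ^ p := by
    rw [Nat.add_sub_cancel, pow_add (n : ℝ)]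
    ring
  rw [e3]
  linarith

end PartitionSums

/-! ### Blocks of the join, restricted words and block counts -/

section Join

variable {M : ℕ}

theorem mem_of_le {π τ : Part M} (h : π ≤ τ) {B : Finset (Fin M)} (hB : B ∈ τ.parts) :
    ∀ E ∈ π.parts, ∀ a ∈ E, ∀ b ∈ E, a ∈ B → b ∈ B := by
  intro E hE a ha b hb haB
  obtain ⟨C, hC, hEC⟩ := h hE
  rw [τ.eq_of_mem_parts hB hC haB (hEC ha)]
  exact hEC hb

theorem le_join_left (π σ : Part M) : π ≤ join π σ := (join_isLUB π σ).1 (Or.inl rfl)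

theorem le_join_right (π σ : Part M) : σ ≤ join π σ := (join_isLUB π σ).1 (Or.inr rfl)

/-- A set that is saturated for `π` and for `σ` is saturated for their join. -/
theorem mem_of_saturated_join {π σ : Part M} {V : Finset (Fin M)}
    (hσ : ∀ E ∈ σ.parts, ∀ a ∈ E, ∀ b ∈ E, a ∈ V → b ∈ V)
    (hπ : ∀ E ∈ π.parts, ∀ a ∈ E, ∀ b ∈ E, a ∈ V → b ∈ V) {B : Finset (Fin M)}
    (hB : B ∈ (join π σ).parts) {a b : Fin M} (ha : a ∈ B) (hb : b ∈ B) (haV : a ∈ V) :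
    b ∈ V := by
  classical
  -- The partition into `V` and its complement is coarser than both `π` and `σ`, hence coarser than
  -- their join.
  let s : Setoid (Fin M) := Setoid.ker (· ∈ V)
  let τ : Part M := Finpartition.ofSetoid s
  have hτ : ∀ ρ : Part M, (∀ E ∈ ρ.parts, ∀ a ∈ E, ∀ b ∈ E, a ∈ V → b ∈ V) → ρ ≤ τ := by
    intro ρ hρ E hE
    obtain ⟨a, ha⟩ := ρ.nonempty_of_mem_parts hE
    refine ⟨τ.part a, τ.part_mem.2 (mem_univ a), fun b hb => ?_⟩
    rw [Finpartition.mem_part_ofSetoid_iff_rel]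
    exact propext ⟨hρ E hE a ha b hb, hρ E hE b hb a ha⟩
  have hle : join π σ ≤ τ := (join_isLUB π σ).2 (by
    rintro ρ (rfl | rfl)
    exacts [hτ _ hπ, hτ _ hσ])
  obtain ⟨C, hC, hBC⟩ := hle hB
  have hC' : τ.part a = C := τ.part_eq_of_mem hC (hBC ha)
  have h : b ∈ τ.part a := hC' ▸ hBC hb
  rw [Finpartition.mem_part_ofSetoid_iff_rel] at h
  exact (iff_of_eq h).1 haV

/-- Words on `B` are extended by a fixed letter off `B`; measurability survives because `B` is a
union of blocks of `σ`. Both parts of the theorem thus become instances of one estimate. -/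
theorem blockSum_le_sum_words {π σ : Part M} {B : Finset (Fin M)}
    (hB : ∀ E ∈ σ.parts, ∀ a ∈ E, ∀ b ∈ E, a ∈ B → b ∈ B) {n : ℕ} (hn : 0 < n) :
    blockSum π σ B n ≤ ∑ j ∈ words σ n with ∀ x ∉ B, j x = ⟨0, hn⟩,
      ∏ E ∈ restrictTo π B, ‖blockCumulant n E (E.restrict j)‖ := by
  classical
  let ext : (B → Fin n) → Fin M → Fin n := fun j x => if h : x ∈ B then j ⟨x, h⟩ else ⟨0, hn⟩
  have hext : ∀ (j : B → Fin n) (x : Fin M) (h : x ∈ B), ext j x = j ⟨x, h⟩ := fun j x h =>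
    dif_pos h
  have hinj : Function.Injective ext := fun j j' h => funext fun x => by
    rw [← hext j x x.2, ← hext j' x x.2, h]
  have hval : ∀ j : B → Fin n, (∏ A : restrictTo π B, ‖blockCumulant n (A : Finset (Fin M))
      (Finset.restrict₂ (π := fun _ => Fin n) (subset_of_mem_restrictTo A.2) j)‖) =
      ∏ E ∈ restrictTo π B, ‖blockCumulant n E (E.restrict (ext j))‖ := by
    intro j
    rw [← Finset.prod_coe_sort (restrictTo π B)
      (fun E => ‖blockCumulant n E (E.restrict (ext j))‖)]
    refine Finset.prod_congr rfl fun A _ => ?_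
    congr 2
    funext x
    exact (hext j x (subset_of_mem_restrictTo A.2 x.2)).symm
  rw [blockSum, Finset.sum_congr rfl fun j _ => hval j,
    ← Finset.sum_image (s := wordsOn σ B n) (g := ext)
      (f := fun j => ∏ E ∈ restrictTo π B, ‖blockCumulant n E (E.restrict j)‖) hinj.injOn]
  refine Finset.sum_le_sum_of_subset_of_nonneg ?_ fun _ _ _ =>
    Finset.prod_nonneg fun _ _ => norm_nonneg _
  intro j hj
  obtain ⟨j, hj', rfl⟩ := Finset.mem_image.1 hj
  clear hj
  simp only [wordsOn, words, Finset.mem_filter, Finset.mem_univ, true_and] at hj' ⊢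
  refine ⟨fun E hE a ha b hb => ?_, fun x hx => dif_neg hx⟩
  by_cases haB : a ∈ B
  · have hEB : E ⊆ B := fun c hc => hB E hE a ha c hc haB
    rw [hext j a haB, hext j b (hEB hb)]
    exact hj' E (Finset.mem_filter.2 ⟨hE, hEB⟩) _ _ ha hb
  · have hbB : b ∉ B := fun hbB => haB (hB E hE b hb a ha hbB)
    simp [ext, haB, hbB]

theorem card_eq_two_mul_halfSize {A : Finset (Fin M)} (h : Even A.card) :
    A.card = 2 * halfSize A := by
  obtain ⟨m, hm⟩ := h
  rw [halfSize]
  omega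

theorem one_le_halfSize {A : Finset (Fin M)} (h : Even A.card) (hA : A.Nonempty) :
    1 ≤ halfSize A := by
  have := card_eq_two_mul_halfSize h
  have := hA.card_pos
  omega

theorem restrictTo_univ (π : Part M) : restrictTo π univ = π.parts :=
  Finset.filter_true_of_mem fun E _ => Finset.subset_univ E

/-- If exactly one member of a family of even blocks has half-size at least `3` and none has
half-size `2`, then the other members are pairs. -/
theorem exists_unique_large_block {π : Part M} (hπ : ∀ A ∈ π.parts, Even A.card)
    {S : Finset (Finset (Fin M))} (hS : S ⊆ π.parts) (h3 : #{A ∈ S | 3 ≤ halfSize A} = 1)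
    (h2 : #{A ∈ S | halfSize A = 2} = 0) :
    ∃ A ∈ S, 3 ≤ halfSize A ∧ ∀ E ∈ S, E ≠ A → E.card = 2 := by
  obtain ⟨A, hA⟩ := Finset.card_eq_one.1 h3
  have hmem : A ∈ ({A ∈ S | 3 ≤ halfSize A} : Finset _) := hA ▸ Finset.mem_singleton_self A
  obtain ⟨hAS, hA3⟩ := Finset.mem_filter.1 hmem
  refine ⟨A, hAS, hA3, fun E hE hEA => ?_⟩
  have h1 := one_le_halfSize (hπ E (hS hE)) (π.nonempty_of_mem_parts (hS hE))
  have hE2 : halfSize E ≠ 2 := fun h =>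
    (Finset.filter_eq_empty_iff.1 (Finset.card_eq_zero.1 h2)) hE h
  have hE3 : ¬ 3 ≤ halfSize E := fun h => hEA <| by
    have : E ∈ ({A ∈ S | 3 ≤ halfSize A} : Finset _) := Finset.mem_filter.2 ⟨hE, h⟩
    rw [hA] at this
    exact Finset.mem_singleton.1 this
  rw [card_eq_two_mul_halfSize (hπ E (hS hE))]
  omega

theorem numBlocks_eq {π : Part M} (hπ : ∀ A ∈ π.parts, Even A.card) (γ : ℕ) :
    numBlocks π γ = #{A ∈ π.parts | halfSize A = γ} := by
  rw [numBlocks]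
  congr 1
  refine Finset.filter_congr fun A hA => ?_
  have := card_eq_two_mul_halfSize (hπ A hA)
  omega

theorem sum_numBlocks_eq {π : Part M} (hπ : ∀ A ∈ π.parts, Even A.card) {K : ℕ}
    (hM : M ≤ 2 * K) :
    ∑ γ ∈ Icc 3 K, numBlocks π γ = #{A ∈ π.parts | 3 ≤ halfSize A} := by
  rw [Finset.card_eq_sum_card_fiberwise (f := halfSize) (t := Icc 3 K)]
  · refine Finset.sum_congr rfl fun γ hγ => ?_
    rw [numBlocks_eq hπ, Finset.filter_filter]
    congr 1
    refine Finset.filter_congr fun A _ => ?_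
    have := Finset.mem_Icc.1 hγ
    constructor
    · rintro rfl; exact ⟨this.1, rfl⟩
    · exact fun h => h.2
  · intro A hA
    have h := (Finset.mem_filter.1 (Finset.mem_coe.1 hA)).2
    refine Finset.mem_coe.2 (Finset.mem_Icc.2 ⟨h, ?_⟩)
    have := Finset.card_le_univ A
    rw [Fintype.card_fin] at this
    rw [halfSize]
    omega

theorem even_card_of_mem_pi1 {r : ℕ} (k : Fin r → ℕ) : ∀ E ∈ (pi1 k).parts, Even E.card := by
  intro E hE
  obtain ⟨⟨i, t⟩, -, rfl⟩ := Finset.mem_image.1 (show E ∈ pi1Blocks k from hE)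
  rw [pi1Block, Finset.card_pair]
  · exact even_two
  · intro h
    have h1 := finSigmaFinEquiv.injective h
    simp only [Sigma.mk.injEq, heq_eq_eq, true_and, Fin.mk.injEq] at h1
    have h2 := t.2
    -- The two local positions have different parities, also when the cycle wraps around.
    have h3 : (2 * (t : ℕ) + 2) % (2 * k i) % 2 = 0 := by
      rw [Nat.mod_mul_right_mod]; omega
    omega

end Join

end SpearmanCumulant

end

/-! ### The two bounds -/

open SpearmanCumulant in
theorem mainTheorem4 {r : ℕ} (k : Fin r → ℕ) (π : Part (∑ i, 2 * k i))
    (hπ : ∀ A ∈ π.parts, Even A.card) :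
    (∀ B ∈ (join π (pi1 k)).parts,
      #{A ∈ restrictTo π B | 3 ≤ halfSize A} = 1 →
      #{A ∈ restrictTo π B | halfSize A = 2} = 0 →
      ∃ C : ℝ, ∀ n : ℕ, 2 ≤ n →
        blockSum π (pi1 k) B n ≤
          C * (n : ℝ) ^ (∑ A ∈ restrictTo π B with 2 ≤ halfSize A, (halfSize A - 2))) ∧
    (numBlocks π 2 = 0 →
      ∑ γ ∈ Icc 3 (∑ i, k i), numBlocks π γ = 1 →
      ∃ C : ℝ, ∀ n : ℕ, 2 ≤ n →
        ∑ j ∈ words (pi1 k) n, ‖partCumulant π j‖ ≤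
          C * (n : ℝ) ^ ((join π (pi1 k)).parts.card - 1 +
            ∑ γ ∈ Icc 2 (∑ i, k i), (γ - 2) * numBlocks π γ)) := by
  have hσ := even_card_of_mem_pi1 k
  constructor
  · intro B hB h3 h2
    obtain ⟨A, hA, hA3, hP⟩ := exists_unique_large_block hπ (Finset.filter_subset _ _) h3 h2
    obtain ⟨hAπ, hAB⟩ := Finset.mem_filter.1 hA
    obtain ⟨a, ha⟩ := π.nonempty_of_mem_parts hAπ
    -- No free starting points are needed: `B` is a single block of the join, so everything in it is
    -- reached from `A`.
    obtain ⟨C, hC⟩ := exists_sum_prod_norm_blockCumulant_le (T₀ := ∅) hπ hσ hA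
      (mem_of_le (le_join_left π (pi1 k)) hB) hP hA3 (card_eq_two_mul_halfSize (hπ A hAπ))
      (fun V hAV _ hBV hVσ hVπ => by
        refine Finset.eq_univ_of_forall fun x => ?_
        by_cases hx : x ∈ B
        · exact mem_of_saturated_join hVσ hVπ hB (hAB ha) hx (hAV ha)
        · exact hBV (Finset.mem_compl.2 hx))
    refine ⟨|C|, fun n hn => ?_⟩
    have hn1 : (1 : ℝ) ≤ n := by exact_mod_cast (by omega : 1 ≤ n)
    refine (blockSum_le_sum_words (mem_of_le (le_join_right π (pi1 k)) hB)
      (by omega)).trans ((hC n hn).trans ?_)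
    refine mul_le_mul (le_abs_self C) (pow_le_pow_right₀ hn1 ?_) (by positivity) (abs_nonneg C)
    rw [Finset.card_empty, zero_add]
    -- The term of `A` alone already gives the required exponent `m - 2`.
    exact Finset.single_le_sum (f := fun A => halfSize A - 2) (fun _ _ => Nat.zero_le _)
      (Finset.mem_filter.2 ⟨hA, by omega⟩)
  · intro h2 h3
    rw [sum_numBlocks_eq hπ (by rw [← Finset.mul_sum])] at h3
    rw [numBlocks_eq hπ] at h2
    obtain ⟨A, hAπ, hA3, hP⟩ := exists_unique_large_block hπ (Finset.Subset.refl _) h3 h2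
    obtain ⟨a, ha⟩ := π.nonempty_of_mem_parts hAπ
    have hrep : ∀ D ∈ (join π (pi1 k)).parts, ∃ x, x ∈ D := fun D hD =>
      (join π (pi1 k)).nonempty_of_mem_parts hD
    have : Nonempty (Fin (∑ i, 2 * k i)) := ⟨a⟩
    choose! rep hrep using hrep
    have ha' := (join π (pi1 k)).part_mem.2 (mem_univ a)
    -- `T₀` has one representative in each block of the join other than the one containing `A`,
    -- which is reached from `A` itself.
    obtain ⟨C, hC⟩ := exists_sum_prod_norm_blockCumulant_le (B := univ)
      (T₀ := ((join π (pi1 k)).parts.erase ((join π (pi1 k)).part a)).image rep) hπ hσ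
      (by rwa [restrictTo_univ]) (fun _ _ _ _ b _ _ => mem_univ b) (by rwa [restrictTo_univ]) hA3
      (card_eq_two_mul_halfSize (hπ A hAπ))
      (fun V hAV hTV _ hVσ hVπ => by
        refine Finset.eq_univ_of_forall fun x => ?_
        have hx := (join π (pi1 k)).part_mem.2 (mem_univ x)
        have hxm := (join π (pi1 k)).mem_part (mem_univ x)
        by_cases hxa : (join π (pi1 k)).part x = (join π (pi1 k)).part a
        · rw [hxa] at hxm
          exact mem_of_saturated_join hVσ hVπ ha' ((join π (pi1 k)).mem_part (mem_univ a)) hxm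
            (hAV ha)
        · exact mem_of_saturated_join hVσ hVπ hx (hrep _ hx) hxm
            (hTV (Finset.mem_image_of_mem rep (Finset.mem_erase.2 ⟨hxa, hx⟩))))
    refine ⟨|C|, fun n hn => ?_⟩
    have hn1 : (1 : ℝ) ≤ n := by exact_mod_cast (by omega : 1 ≤ n)
    have h := hC n hn
    simp only [Finset.mem_univ, not_true_eq_false, false_imp_iff, implies_true,
      Finset.filter_true, restrictTo_univ] at h
    simp only [partCumulant, norm_prod]
    refine h.trans (mul_le_mul (le_abs_self C) (pow_le_pow_right₀ hn1 (Nat.add_le_add ?_ ?_))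
      (by positivity) (abs_nonneg C))
    · refine Finset.card_image_le.trans (le_of_eq ?_)
      rw [Finset.card_erase_of_mem ha']
    · have hAk : halfSize A ≤ ∑ i, k i := by
        have hc := Finset.card_le_univ A
        have hs : ∑ i, 2 * k i = 2 * ∑ i, k i := (Finset.mul_sum _ _ _).symm
        rw [Fintype.card_fin] at hc
        rw [halfSize]
        omega
      refine le_trans ?_ (Finset.single_le_sum (f := fun γ => (γ - 2) * numBlocks π γ)
        (fun _ _ => Nat.zero_le _) (Finset.mem_Icc.2 ⟨(by omega : 2 ≤ halfSize A), hAk⟩))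
      refine Nat.le_mul_of_pos_right _ ?_
      rw [numBlocks_eq hπ]
      exact Finset.card_pos.2 ⟨A, Finset.mem_filter.2 ⟨hAπ, rfl⟩⟩
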